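/- Let $\Phi(\boldsymbol w,x)$ be a model with parameter $\boldsymbol w\in\mathbb R^p$, let $(x_i,y_i)_{i=1}^N$ ($N\ge 1$, $y_i\in\mathbb R$) be training data, and put $q_i(\boldsymbol w)=y_i\Phi(\boldsymbol w,x_i)$. Let $f(z)=z$ (exponential loss) or $f(z)=-\log\log(1+e^{-z})$ (logistic loss), and $\mathcal L(\boldsymbol w)=\sum_{i=1}^N e^{-f(q_i(\boldsymbol w))}$. Assume: 1. (Regularity) every $q_i$ is differentiable on $\mathbb R^p$ with locally Lipschitz gradient (for example, $\Phi(\cdot,x)$ is $M'$-smooth for some $M'$ and every $x$). 2. (Homogeneity) there is $L>0$ with $q_i(\alpha\boldsymbol w)=\alpha^Lq_i(\boldsymbol w)$ for all $i$, all $\boldsymbol w$ and all $\alpha>0$. Let $\varepsilon>0$ and let $(\boldsymbol w(t))_{t\ge 0}$ be generated by discrete AdaGrad from an arbitrary $\boldsymbol w(0)$, $$\boldsymbol w(t+1)-\boldsymbol w(t)=-\eta_t\,\boldsymbol h(t)\odot\nabla\mathcal L(\boldsymbol w(t)),\qquad \boldsymbol h_j(t)^{-1}=\sqrt{\varepsilon+\sum_{\tau=0}^{t}\big(\partial_j\mathcal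 L(\boldsymbol w(\tau))\big)^2},\quad j=1,\dots,p.$$ Assume that there are a time $t_0$ and constants $M,\tilde\eta>0$ such that: 3. (Separability) $f^{-1}\big(\log\frac1{\mathcal L(\boldsymbol w(t_0))}\big)>0$. 4. (Smoothness) $\mathcal L$ is $M$-smooth on the sublevel set $S=\{\boldsymbol u:\mathcal L(\boldsymbol u)\le\mathcal L(\boldsymbol w(t_0))\}$, that is, $\|\nabla\mathcal L(\boldsymbol u)-\nabla\mathcal L(\boldsymbol v)\|\le M\|\boldsymbol u-\boldsymbol v\|$ for all $\boldsymbol u,\boldsymbol v\in S$ (for example, $\mathcal L$ is $M$-smooth on $\mathbb R^p$). 5. (Learning rate) for all $t\ge t_0$, $\tilde\eta\le\eta_t\le C(t)$, where $C(t)=\frac1M\min_{j}\boldsymbol h_j(t)^{-1}$, which is non-decreasing in $t$. Then the limit $\boldsymbol h_\infty=\lim_{t\to\infty}\boldsymbol h(t)$ exists and all its components are positive. Moreover, if $\bar{\boldsymbol w}$ is any limit point of the normalized iterates $\hat{\boldsymbol w}(t)=\boldsymbol w(t)/\|\boldsymbol w(t)\|$, then $\bar{\boldsymbol w}$ is along the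 direction of a KKT point of $$\min\ \tfrac12\big\|\boldsymbol h_\infty^{-1/2}\odot\boldsymbol w\big\|\quad\text{subject to } q_i(\boldsymbol w)\ge1,\ i=1,\dots,N,$$ that is, there is $c>0$ such that $\boldsymbol w^*=c\,\bar{\boldsymbol w}$ is feasible and, for some $\lambda_1,\dots,\lambda_N\ge0$, the gradient at $\boldsymbol w^*$ of the objective equals $\sum_i\lambda_i\nabla q_i(\boldsymbol w^*)$ and $\lambda_i(q_i(\boldsymbol w^*)-1)=0$ for all $i$. -/

import Mathlib

open Filter Topology
open scoped BigOperators

/-- The two individual losses `ℓ = e^{-f}`. -/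
inductive LossKind where
  | exponential
  | logistic

/-- The function `f` with `ℓ = e^{-f}`: `f(x) = x` for the exponential loss
`ℓ(x) = e^{-x}` and `f(x) = -log log (1 + e^{-x})` for the logistic loss
`ℓ(x) = log (1 + e^{-x})`. -/
noncomputable def LossKind.f : LossKind → ℝ → ℝ
  | .exponential, x => x
  | .logistic, x => -Real.log (Real.log (1 + Real.exp (-x)))

/-- The margin `q_i(w) = y_i Φ(w, x_i)` of the network `Φ` on the `i`-th training example. -/
def margin {p N : ℕ} {X : Type*} (Φ : EuclideanSpace ℝ (Fin p) → X → ℝ)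
    (x : Fin N → X) (y : Fin N → ℝ) (i : Fin N) (w : EuclideanSpace ℝ (Fin p)) : ℝ :=
  y i * Φ w (x i)

/-- The empirical loss `ℒ(w) = ∑ i, e^{-f(q_i(w))}`. -/
noncomputable def empiricalLoss {p N : ℕ} (k : LossKind)
    (q : Fin N → EuclideanSpace ℝ (Fin p) → ℝ) (w : EuclideanSpace ℝ (Fin p)) : ℝ :=
  ∑ i, Real.exp (-(k.f (q i w)))

/-- The component-wise product `a ⊙ b`. -/
noncomputable def hadamardVec {p : ℕ} (a b : EuclideanSpace ℝ (Fin p)) :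
    EuclideanSpace ℝ (Fin p) :=
  WithLp.toLp 2 (fun j => a j * b j)

/-- The component-wise real power `a^s`. -/
noncomputable def powVec {p : ℕ} (a : EuclideanSpace ℝ (Fin p)) (s : ℝ) :
    EuclideanSpace ℝ (Fin p) :=
  WithLp.toLp 2 (fun j => a j ^ s)

/-- The AdaGrad conditioner `h(t)`, given component-wise by
`h(t)⁻¹ = √(ε + ∑_{τ=0}^{t} (∇F(w(τ)))²)`. -/
noncomputable def adaGradConditioner {p : ℕ} (ε : ℝ) (F : EuclideanSpace ℝ (Fin p) → ℝ)
    (w : ℕ → EuclideanSpace ℝ (Fin p)) (t : ℕ) : EuclideanSpace ℝ (Fin p) :=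
  WithLp.toLp 2
    (fun j => (Real.sqrt (ε + ∑ τ ∈ Finset.range (t + 1), (gradient F (w τ) j) ^ 2))⁻¹)

/-- `w` is a run of discrete AdaGrad on `F` with learning rates `η`:
`w(t+1) - w(t) = -η(t) h(t) ⊙ ∇F(w(t))`. -/
def IsAdaGradRun {p : ℕ} (ε : ℝ) (F : EuclideanSpace ℝ (Fin p) → ℝ) (η : ℕ → ℝ)
    (w : ℕ → EuclideanSpace ℝ (Fin p)) : Prop :=
  ∀ t, w (t + 1) - w t = -(η t • hadamardVec (adaGradConditioner ε F w t) (gradient F (w t)))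

/-- The upper bound `C(t) = min_j (h_j(t)⁻¹) / M` for the learning rate. -/
noncomputable def learningRateBound {p : ℕ} (ε M : ℝ) (F : EuclideanSpace ℝ (Fin p) → ℝ)
    (w : ℕ → EuclideanSpace ℝ (Fin p)) (t : ℕ) : ℝ :=
  (⨅ j, (adaGradConditioner ε F w t j)⁻¹) / M

/-- `F` is `M`-smooth on `S`: it is differentiable at the points of `S`, and its gradient is
`M`-Lipschitz on `S`. -/
def IsSmoothOnWith {p : ℕ} (M : ℝ) (F : EuclideanSpace ℝ (Fin p) → ℝ)
    (S : Set (EuclideanSpace ℝ (Fin p))) : Prop :=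
  (∀ u ∈ S, DifferentiableAt ℝ F u) ∧
    ∀ u ∈ S, ∀ v ∈ S, ‖gradient F u - gradient F v‖ ≤ M * ‖u - v‖

/-- `v` is a KKT point of `min f` subject to `g i ≤ 0` for all `i`. The objective and the
constraints are required to be differentiable at `v`; at points near which they are
continuously differentiable, the gradient is the only Clarke subgradient. -/
structure IsKKTPoint {p N : ℕ} (f : EuclideanSpace ℝ (Fin p) → ℝ)
    (g : Fin N → EuclideanSpace ℝ (Fin p) → ℝ) (v : EuclideanSpace ℝ (Fin p)) : Prop where
  feasible : ∀ i, g i v ≤ 0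
  differentiableAt_objective : DifferentiableAt ℝ f v
  differentiableAt_constraint : ∀ i, DifferentiableAt ℝ (g i) v
  multipliers : ∃ lam : Fin N → ℝ, (∀ i, 0 ≤ lam i) ∧
    gradient f v + ∑ i, lam i • gradient (g i) v = 0 ∧ ∀ i, lam i * g i v = 0

/-! Everything is measured in the moving metric `h(t)⁻¹`. On the sublevel set each step lowers the
loss by at least half of `η G`, where `G = ∑ h_j (∂_j ℒ)²`; hence `∑ G < ∞`. As `h` decreases, this
bounds the accumulated squared gradients, so `h` has a positive limit and the change of metric costs
only summable errors (`exists_tendsto_adaGradConditioner`, `summable_adaGradGrowth`).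

Let `z = ℓ⁻¹(ℒ)` be the smoothed margin, `R = ∑ h_j⁻¹ w_j²` and `ν = ∑ -ℓ'(q_i) q_i`. Euler's
identity gives `⟨∇ℒ, w⟩ = -L ν`. Put `a = L η ν / R` and `D = G R / (L ν)² - 1`; by Cauchy–Schwarz
`D ≥ 0`, and `D` measures how far `w` is from being parallel to `h ⊙ ∇ℒ`. Up to summable errors `log
R` grows by at most `2 a`, while for large margins `log z` grows by at least `(1 - e) L a (1 + D)`,
where `e` is the relative second-order error of the step. If `∑ e a < ∞`, then `log (z / R^(L/2))`,
which is bounded above, is almost increasing, and `∑ a D < ∞` follows. The error is bootstrapped: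
smoothness allows `e = 1/2`, which already bounds `R^L` by a multiple of `z⁴`; then `ℓ(z) R^L` is
exponentially small in `z`, and a Taylor expansion of `ℒ` allows `e` of that order
(`MarginDynamics.alignment`).

Since `R → ∞`, the sum of `a` diverges, whereas the directions move by `O(a)` per step. So every
limit direction is reached along times with `D → 0` (`MapClusterPt.prodMk_zero_of_summable`). There
stationarity holds approximately (`stationarity_error_le`) with bounded multipliers, and the
multiplier of a non-minimal margin vanishes in the limit, because the slopes decay exponentially in
`‖w‖^L` times the gap. Rescaling the limit so that its smallest margin is `1` gives the KKT point.
-/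

namespace LossKind

/-! ### Calculus of the exponential and logistic losses. -/

/-- The individual loss `ℓ = e^{-f}`. -/
noncomputable def loss (k : LossKind) (x : ℝ) : ℝ := Real.exp (-(k.f x))

/-- The absolute value `-ℓ'` of the derivative of the individual loss. -/
noncomputable def slope : LossKind → ℝ → ℝ
  | .exponential, x => Real.exp (-x)
  | .logistic, x => (1 + Real.exp x)⁻¹

lemma loss_exponential (x : ℝ) : loss .exponential x = Real.exp (-x) := rfl

lemma log_one_add_exp_pos (x : ℝ) : 0 < Real.log (1 + Real.exp x) :=
  Real.log_pos (by linarith [Real.exp_pos x])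

lemma loss_logistic (x : ℝ) : loss .logistic x = Real.log (1 + Real.exp (-x)) := by
  simp only [loss, f, neg_neg]
  exact Real.exp_log (log_one_add_exp_pos _)

lemma slope_logistic (x : ℝ) :
    slope .logistic x = Real.exp (-x) / (1 + Real.exp (-x)) := by
  have := Real.exp_pos x
  simp only [slope, Real.exp_neg]
  field_simp
  ring

lemma loss_pos (k : LossKind) (x : ℝ) : 0 < k.loss x := Real.exp_pos _

lemma slope_pos (k : LossKind) (x : ℝ) : 0 < k.slope x := by
  cases k
  · exact Real.exp_pos _
  · have := Real.exp_pos x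
    simp only [slope]
    positivity

lemma hasDerivAt_loss (k : LossKind) (x : ℝ) : HasDerivAt k.loss (-(k.slope x)) x := by
  have h1 : HasDerivAt (fun x : ℝ => Real.exp (-x)) (-Real.exp (-x)) x := by
    simpa using (hasDerivAt_neg x).exp
  cases k
  · exact h1
  · have h2 : loss .logistic = fun x => Real.log (1 + Real.exp (-x)) := funext loss_logistic
    rw [h2, slope_logistic, ← neg_div]
    exact (h1.const_add 1).log (by have := Real.exp_pos (-x); positivity)

lemma loss_strictAnti (k : LossKind) : StrictAnti k.loss :=
  strictAnti_of_deriv_neg fun x => by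
    rw [(k.hasDerivAt_loss x).deriv]
    linarith [k.slope_pos x]

lemma slope_antitone (k : LossKind) : Antitone k.slope := by
  intro x y hxy
  cases k
  · exact Real.exp_le_exp.2 (by linarith)
  · have := Real.exp_le_exp.2 hxy
    have := Real.exp_pos x
    simp only [slope]
    gcongr

/-- The logarithmic derivative of the slope is at least `-1`. This makes the slope Lipschitz on `[z,
∞)` with constant `slope z`. -/
lemma slope_mul_exp_le (k : LossKind) {x y : ℝ} (hxy : x ≤ y) :
    k.slope x * Real.exp (-(y - x)) ≤ k.slope y := by
  cases k
  · simp only [slope, ← Real.exp_add]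
    exact Real.exp_le_exp.2 (by linarith)
  · have hx := Real.exp_pos x
    have hy := Real.exp_pos y
    simp only [slope]
    have h1 : Real.exp (-(y - x)) ≤ 1 := Real.exp_le_one_iff.2 (by linarith)
    have h2 : Real.exp (-(y - x)) * Real.exp y = Real.exp x := by
      rw [← Real.exp_add]; congr 1; ring
    rw [inv_mul_eq_div, ← one_div, div_le_div_iff₀ (by positivity) (by positivity)]
    nlinarith

lemma slope_le_exp (k : LossKind) (x : ℝ) : k.slope x ≤ Real.exp (-x) := by
  cases k
  · exact le_rfl
  · have := Real.exp_pos x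
    simp only [slope, Real.exp_neg]
    gcongr
    linarith

lemma exp_le_two_mul_slope (k : LossKind) {x : ℝ} (hx : 0 ≤ x) :
    Real.exp (-x) ≤ 2 * k.slope x := by
  cases k
  · have := Real.exp_pos (-x)
    simp only [slope]
    linarith
  · have h1 := Real.one_le_exp hx
    simp only [slope, Real.exp_neg]
    rw [← one_div, ← div_eq_mul_inv, div_le_div_iff₀ (by positivity) (by positivity)]
    linarith

lemma slope_le_loss (k : LossKind) (x : ℝ) : k.slope x ≤ k.loss x := by
  cases k
  · exact le_rfl
  · have h := Real.exp_pos (-x)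
    rw [slope_logistic, loss_logistic]
    have := Real.one_sub_inv_le_log_of_pos (show 0 < 1 + Real.exp (-x) by positivity)
    refine le_trans (le_of_eq ?_) this
    field_simp
    ring

lemma loss_le_exp (k : LossKind) (x : ℝ) : k.loss x ≤ Real.exp (-x) := by
  cases k
  · exact le_rfl
  · have h := Real.exp_pos (-x)
    rw [loss_logistic]
    have := Real.log_le_sub_one_of_pos (show 0 < 1 + Real.exp (-x) by positivity)
    linarith

/-- The quotient `slope / loss` is `f'`, so this is the convexity of `f`. For the logistic loss it
reduces to `e^x log (1 + e^{-x}) ≤ 1`. -/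
lemma slope_mul_loss_le (k : LossKind) {x y : ℝ} (hxy : x ≤ y) :
    k.slope x * k.loss y ≤ k.slope y * k.loss x := by
  suffices h : Monotone fun x => k.slope x / k.loss x by
    have := h hxy
    simp only at this
    rwa [div_le_div_iff₀ (k.loss_pos _) (k.loss_pos _)] at this
  cases k
  · intro a b _
    have ha := (Real.exp_pos (-a)).ne'
    have hb := (Real.exp_pos (-b)).ne'
    simp [slope, loss_exponential]
  · have hslope : ∀ x, HasDerivAt (slope .logistic)
        (-(Real.exp x) / (1 + Real.exp x) ^ 2) x := fun x =>
      ((Real.hasDerivAt_exp x).const_add 1).inv (by have := Real.exp_pos x; positivity)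
    have hd : ∀ x, HasDerivAt (fun x => slope .logistic x / loss .logistic x)
        ((-(Real.exp x) / (1 + Real.exp x) ^ 2 * loss .logistic x
          - slope .logistic x * (-(slope .logistic x))) / loss .logistic x ^ 2) x := fun x =>
      (hslope x).div (hasDerivAt_loss .logistic x) (loss_pos _ x).ne'
    refine monotone_of_hasDerivAt_nonneg hd fun x => ?_
    have hx := Real.exp_pos x
    have hl := loss_le_exp .logistic x
    refine div_nonneg ?_ (by positivity)
    have : -(Real.exp x) / (1 + Real.exp x) ^ 2 * loss .logistic x
        - slope .logistic x * (-(slope .logistic x))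
        = (1 - Real.exp x * loss .logistic x) / (1 + Real.exp x) ^ 2 := by
      simp only [slope]
      field_simp
      ring
    rw [this]
    refine div_nonneg ?_ (by positivity)
    have h2 : Real.exp x * Real.exp (-x) = 1 := by rw [← Real.exp_add]; simp
    nlinarith

/-- The function `x / (1 + e^x)` decreases as soon as `x e^x ≥ 1 + e^x`, for which `2 ≤ x` suffices.
The later assumptions `2 ≤ z` go back to this threshold. -/
lemma slope_mul_self_antitoneOn (k : LossKind) :
    AntitoneOn (fun x => k.slope x * x) (Set.Ici 2) := by
  intro x hx y hy hxy
  simp only [Set.mem_Ici] at hx hy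
  have hxe := Real.exp_pos x
  have h1 : Real.exp x * (1 + (y - x)) ≤ Real.exp y := by
    have h2 : Real.exp y = Real.exp x * Real.exp (y - x) := by
      rw [← Real.exp_add]; congr 1; ring
    rw [h2]
    gcongr
    linarith [Real.add_one_le_exp (y - x)]
  have h3 := Real.one_le_exp (show 0 ≤ x by linarith)
  have h4 : 0 ≤ (y - x) * (x * Real.exp x - Real.exp x - 1) :=
    mul_nonneg (by linarith) (by nlinarith)
  cases k
  · simp only [slope, Real.exp_neg]
    rw [inv_mul_eq_div, inv_mul_eq_div, div_le_div_iff₀ (Real.exp_pos _) hxe]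
    nlinarith
  · simp only [slope]
    have := Real.exp_pos y
    rw [inv_mul_eq_div, inv_mul_eq_div, div_le_div_iff₀ (by positivity) (by positivity)]
    nlinarith

lemma exists_loss_eq (k : LossKind) {v : ℝ} (hv : 0 < v) : ∃ z, k.loss z = v := by
  cases k
  · exact ⟨-Real.log v, by rw [loss_exponential, neg_neg, Real.exp_log hv]⟩
  · have h : 0 < Real.exp v - 1 := by linarith [Real.add_one_lt_exp hv.ne']
    refine ⟨-Real.log (Real.exp v - 1), ?_⟩
    rw [loss_logistic, neg_neg, Real.exp_log h, add_sub_cancel, Real.log_exp]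

/-- Convexity of the individual loss. -/
lemma loss_sub_loss_le (k : LossKind) {x y : ℝ} (hxy : x ≤ y) :
    k.loss x - k.loss y ≤ k.slope x * (y - x) := by
  have h := Convex.norm_image_sub_le_of_norm_hasDerivWithin_le
    (f := k.loss) (f' := fun x => -(k.slope x)) (C := k.slope x) (s := Set.Icc x y)
    (fun u _ => (k.hasDerivAt_loss u).hasDerivWithinAt)
    (fun u hu => by
      rw [norm_neg, Real.norm_of_nonneg (k.slope_pos u).le]
      exact k.slope_antitone hu.1) (convex_Icc x y)
    (Set.left_mem_Icc.2 hxy) (Set.right_mem_Icc.2 hxy)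
  rw [Real.norm_of_nonneg (sub_nonneg.2 hxy)] at h
  have := neg_abs_le (k.loss y - k.loss x)
  rw [Real.norm_eq_abs] at h
  linarith

lemma abs_slope_sub_le (k : LossKind) {z x y : ℝ} (hx : z ≤ x) (hy : z ≤ y) :
    |k.slope x - k.slope y| ≤ k.slope z * |x - y| := by
  wlog hxy : x ≤ y generalizing x y
  · rw [abs_sub_comm, abs_sub_comm x y]
    exact this hy hx (by linarith)
  have h1 := k.slope_antitone hxy
  have h2 := k.slope_antitone hx
  have h3 := k.slope_mul_exp_le hxy
  have h4 := Real.add_one_le_exp (-(y - x))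
  have h5 := k.slope_pos x
  rw [abs_of_nonneg (by linarith), abs_of_nonpos (by linarith)]
  have h6 : k.slope x * (-(y - x) + 1) ≤ k.slope y := le_trans (by gcongr) h3
  have h7 : k.slope x * (y - x) ≤ k.slope z * (y - x) := by
    gcongr
  linarith

/-- First-order expansion of the individual loss, to the right of `z`. -/
lemma loss_le_taylor (k : LossKind) {z x y : ℝ} (hx : z ≤ x) (hy : z ≤ y) :
    k.loss y ≤ k.loss x - k.slope x * (y - x) + k.slope z * (y - x) ^ 2 := by
  have h := Convex.norm_image_sub_le_of_norm_hasDerivWithin_le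
    (f := fun u => k.loss u + k.slope x * u) (f' := fun u => -(k.slope u) + k.slope x)
    (C := k.slope z * |y - x|) (s := Set.uIcc x y)
    (fun u _ => by
      have h := ((k.hasDerivAt_loss u).add
        ((hasDerivAt_id u).const_mul (k.slope x))).hasDerivWithinAt (s := Set.uIcc x y)
      rw [mul_one] at h
      exact h)
    (fun u hu => by
      have hu1 : z ≤ u := le_trans (le_inf hx hy) hu.1
      rw [neg_add_eq_sub, Real.norm_eq_abs]
      refine (k.abs_slope_sub_le hx hu1).trans ?_
      have := k.slope_pos z
      gcongr k.slope z * ?_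
      rw [abs_sub_comm]
      exact Set.abs_sub_left_of_mem_uIcc hu) (convex_uIcc x y)
    Set.left_mem_uIcc Set.right_mem_uIcc
  rw [Real.norm_eq_abs, Real.norm_eq_abs, mul_assoc, ← sq, sq_abs] at h
  have := le_abs_self (k.loss y + k.slope x * y - (k.loss x + k.slope x * x))
  linarith

/-- The logarithm of `ℓ⁻¹` is convex on `(0, ℓ 2]`. -/
lemma loss_sub_loss_le_mul_log (k : LossKind) {z z' : ℝ} (hz : 2 ≤ z) (hzz : z ≤ z') :
    k.loss z - k.loss z' ≤ k.slope z * z * (Real.log z' - Real.log z) := by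
  -- The derivative at `s` is `(slope z * z - slope s * s) / s`, which is non-negative because
  -- `slope s * s` decreases beyond `2`.
  have hmono : MonotoneOn (fun s => k.slope z * z * Real.log s + k.loss s) (Set.Ici z) := by
    have hd : ∀ s ∈ Set.Ici z, HasDerivAt (fun s => k.slope z * z * Real.log s + k.loss s)
        (k.slope z * z * s⁻¹ + -(k.slope s)) s := fun s hs => by
      have hs' : 0 < s := by simp only [Set.mem_Ici] at hs; linarith
      exact ((Real.hasDerivAt_log hs'.ne').const_mul _).add (k.hasDerivAt_loss s)
    refine monotoneOn_of_deriv_nonneg (convex_Ici z)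
      (fun s hs => (hd s hs).continuousAt.continuousWithinAt)
      (fun s hs => ?_) (fun s hs => ?_)
    · exact (hd s (interior_subset hs)).differentiableAt.differentiableWithinAt
    · have hs1 := interior_subset hs
      rw [(hd s hs1).deriv]
      simp only [Set.mem_Ici] at hs1
      have h := k.slope_mul_self_antitoneOn (a := z) (b := s) hz
        (show s ∈ Set.Ici (2 : ℝ) by simp only [Set.mem_Ici]; linarith) hs1
      simp only at h
      have hs' : 0 < s := by linarith
      have : k.slope s ≤ k.slope z * z * s⁻¹ := by
        rw [← div_eq_mul_inv, le_div_iff₀ hs']; exact h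
      linarith
  have := hmono (Set.self_mem_Ici) (show z' ∈ Set.Ici z from hzz) hzz
  simp only at this
  linarith

end LossKind

/-! ### Telescoping with summable errors, and the scalar dynamics of the margin. -/

/-- If `Ψ` increases by at least `b` up to the errors `κ`, then its increments control the partial
sums of `b`. -/
lemma sum_range_le_of_add_le {Ψ b κ : ℕ → ℝ} (hκ0 : ∀ t, 0 ≤ κ t) (hκ : Summable κ)
    (h : ∀ t, Ψ t + b t ≤ Ψ (t + 1) + κ t) (n : ℕ) :
    ∑ i ∈ Finset.range n, b i ≤ Ψ n - Ψ 0 + ∑' i, κ i := by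
  have h1 : ∑ i ∈ Finset.range n, b i ≤ Ψ n - Ψ 0 + ∑ i ∈ Finset.range n, κ i := by
    induction n with
    | zero => simp
    | succ n ih =>
      rw [Finset.sum_range_succ, Finset.sum_range_succ]
      linarith [h n]
  linarith [hκ.sum_le_tsum (Finset.range n) (fun i _ => hκ0 i)]

lemma summable_of_add_le {Ψ b κ : ℕ → ℝ} {U : ℝ} (hb : ∀ t, 0 ≤ b t) (hκ0 : ∀ t, 0 ≤ κ t)
    (hκ : Summable κ) (h : ∀ t, Ψ t + b t ≤ Ψ (t + 1) + κ t) (hU : ∀ t, Ψ t ≤ U) :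
    Summable b :=
  summable_of_sum_range_le (c := U - Ψ 0 + ∑' i, κ i) hb fun n => by
    linarith [sum_range_le_of_add_le hκ0 hκ h n, hU n]

lemma le_of_le_add {Ψ κ : ℕ → ℝ} (hκ0 : ∀ t, 0 ≤ κ t) (hκ : Summable κ)
    (h : ∀ t, Ψ t ≤ Ψ (t + 1) + κ t) (n : ℕ) : Ψ 0 - ∑' i, κ i ≤ Ψ n := by
  have := sum_range_le_of_add_le (b := fun _ => 0) hκ0 hκ (by simpa using h) n
  simp only [Finset.sum_const_zero] at this
  linarith

/-- The scalar dynamics of a descent method on a homogeneous model: `z` is the smoothed margin,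
`R` the squared norm, `a` the growth rate of `log R / 2` and `D` the deviation from alignment. -/
structure MarginDynamics (k : LossKind) (L c B : ℝ) (z R a D κ ν : ℕ → ℝ) : Prop where
  hL : 0 < L
  hc : 0 < c
  hB : 0 < B
  z_pos : ∀ t, 0 < z t
  R_pos : ∀ t, 0 < R t
  a_nonneg : ∀ t, 0 ≤ a t
  D_nonneg : ∀ t, 0 ≤ D t
  κ_nonneg : ∀ t, 0 ≤ κ t
  summable_κ : Summable κ
  log_R_le : ∀ t, Real.log (R (t + 1)) ≤ Real.log (R t) + 2 * a t + κ t
  -- For a run, `L ν a (1 + D)` is the learning rate times the decrement, that is, the first-order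
  -- decrease of the loss. The factor `1 / 2` is the price of the descent lemma.
  descent : ∀ t, 1 / 2 * (L * ν t * a t * (1 + D t)) ≤ k.loss (z t) - k.loss (z (t + 1))
  le_ν : ∀ t, k.slope (z t) * z t ≤ ν t
  z_le : ∀ t, z t ≤ B * R t ^ (L / 2)
  le_a : ∀ t, c * (ν t / R t) ≤ a t

namespace MarginDynamics

variable {k : LossKind} {L c B : ℝ} {z R a D κ ν : ℕ → ℝ}

lemma ν_pos (h : MarginDynamics k L c B z R a D κ ν) (t : ℕ) : 0 < ν t :=
  (mul_pos (k.slope_pos _) (h.z_pos t)).trans_le (h.le_ν t)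

lemma shift (h : MarginDynamics k L c B z R a D κ ν) (T : ℕ) :
    MarginDynamics k L c B (fun t => z (t + T)) (fun t => R (t + T)) (fun t => a (t + T))
      (fun t => D (t + T)) (fun t => κ (t + T)) (fun t => ν (t + T)) where
  hL := h.hL
  hc := h.hc
  hB := h.hB
  z_pos t := h.z_pos _
  R_pos t := h.R_pos _
  a_nonneg t := h.a_nonneg _
  D_nonneg t := h.D_nonneg _
  κ_nonneg t := h.κ_nonneg _
  summable_κ := (summable_nat_add_iff T).2 h.summable_κ
  log_R_le t := by simpa [add_right_comm] using h.log_R_le (t + T)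
  descent t := by simpa [add_right_comm] using h.descent (t + T)
  le_ν t := h.le_ν _
  z_le t := h.z_le _
  le_a t := h.le_a _

lemma z_le_succ (h : MarginDynamics k L c B z R a D κ ν) (t : ℕ) : z t ≤ z (t + 1) := by
  refine k.loss_strictAnti.le_iff_ge.1 ?_
  have h1 := h.descent t
  have h2 : 0 ≤ L * ν t * a t * (1 + D t) := by
    have := h.ν_pos t
    have := h.a_nonneg t
    have := h.D_nonneg t
    have := h.hL
    positivity
  linarith

lemma z_monotone (h : MarginDynamics k L c B z R a D κ ν) : Monotone z :=
  monotone_nat_of_le_succ h.z_le_succ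

/-- Convexity of the loss turns its decrease into an increase of the margin; the slope cancels
because `slope (z t) * z 0 ≤ ν t`. -/
lemma z_increment (h : MarginDynamics k L c B z R a D κ ν) (t : ℕ) :
    z t + L / 2 * z 0 * a t ≤ z (t + 1) := by
  have h1 := h.descent t
  have h2 := k.loss_sub_loss_le (h.z_le_succ t)
  have hs := k.slope_pos (z t)
  have ha := h.a_nonneg t
  have hD := h.D_nonneg t
  have hL := h.hL
  have h3 : k.slope (z t) * (L / 2 * z 0 * a t) ≤ 1 / 2 * (L * ν t * a t * (1 + D t)) := by
    have hz0 := h.z_monotone (Nat.zero_le t)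
    have hν : k.slope (z t) * z 0 ≤ ν t := le_trans (by gcongr) (h.le_ν t)
    have hν' := h.ν_pos t
    calc k.slope (z t) * (L / 2 * z 0 * a t) = 1 / 2 * (L * (k.slope (z t) * z 0) * a t * 1) := by
          ring
      _ ≤ _ := by
          gcongr
          linarith
  have h4 : k.slope (z t) * (L / 2 * z 0 * a t) ≤ k.slope (z t) * (z (t + 1) - z t) := by linarith
  linarith [le_of_mul_le_mul_left h4 hs]

lemma log_R_le_sum (h : MarginDynamics k L c B z R a D κ ν) (n : ℕ) :
    Real.log (R n) ≤ Real.log (R 0) + 2 * ∑ i ∈ Finset.range n, a i + ∑' i, κ i := by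
  have := sum_range_le_of_add_le (Ψ := fun t => -Real.log (R t)) (b := fun t => -(2 * a t))
    h.κ_nonneg h.summable_κ (fun t => by linarith [h.log_R_le t]) n
  rw [Finset.sum_neg_distrib, ← Finset.mul_sum] at this
  linarith

lemma R_bounded_of_summable (h : MarginDynamics k L c B z R a D κ ν) (ha : Summable a) :
    ∃ U, 0 < U ∧ ∀ t, R t ≤ U := by
  refine ⟨Real.exp (Real.log (R 0) + 2 * ∑' i, a i + ∑' i, κ i), Real.exp_pos _, fun t => ?_⟩
  rw [← Real.log_le_iff_le_exp (h.R_pos t)]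
  have := ha.sum_le_tsum (Finset.range t) (fun i _ => h.a_nonneg i)
  linarith [h.log_R_le_sum t]

/-- If the margin stayed bounded, `z_increment` would make `a` summable and hence `R` bounded; but
then `ν / R`, and with it `a`, would stay above a positive constant. -/
lemma tendsto_z (h : MarginDynamics k L c B z R a D κ ν) : Tendsto z atTop atTop := by
  refine tendsto_atTop_atTop_of_monotone h.z_monotone ?_
  by_contra! hZ
  obtain ⟨Z, hZ⟩ := hZ
  have hz0 := h.z_pos 0
  have hc := h.hc
  have ha : Summable a := by
    have h1 : Summable fun t => L / 2 * z 0 * a t :=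
      summable_of_add_le (Ψ := z) (κ := fun _ => 0) (U := Z)
        (fun t => by have := h.a_nonneg t; have := h.hL; positivity)
        (fun _ => le_rfl) summable_zero (fun t => by simpa using h.z_increment t)
        (fun t => (hZ t).le)
    exact (summable_mul_left_iff (by have := h.hL; positivity)).1 h1
  obtain ⟨U, hU0, hU⟩ := h.R_bounded_of_summable ha
  have hlow : ∀ t, c * (k.slope Z * z 0 / U) ≤ a t := fun t => by
    refine le_trans ?_ (h.le_a t)
    have h1 := h.le_ν t
    have h2 := h.z_monotone (Nat.zero_le t)
    have h3 := k.slope_antitone (hZ t).le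
    have h4 := h.R_pos t
    have h5 := hU t
    have h6 := k.slope_pos Z
    have h6' := k.slope_pos (z t)
    have h7 : k.slope Z * z 0 ≤ ν t := le_trans (by gcongr) h1
    have h8 := h.ν_pos t
    gcongr
  have h1 := ge_of_tendsto' ha.tendsto_atTop_zero hlow
  have h2 := k.slope_pos Z
  have : 0 < c * (k.slope Z * z 0 / U) := by positivity
  linarith

lemma tendsto_R (h : MarginDynamics k L c B z R a D κ ν) : Tendsto R atTop atTop := by
  have hL := h.hL
  have h1 : Tendsto (fun t => R t ^ (L / 2)) atTop atTop := by
    refine tendsto_atTop_mono (fun t => ?_) (h.tendsto_z.atTop_div_const h.hB)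
    rw [div_le_iff₀' h.hB]
    exact h.z_le t
  have h2 := (tendsto_rpow_atTop (show 0 < 2 / L by positivity)).comp h1
  refine h2.congr fun t => ?_
  simp only [Function.comp]
  rw [← Real.rpow_mul (h.R_pos t).le, show L / 2 * (2 / L) = 1 by field_simp, Real.rpow_one]

lemma not_summable_a (h : MarginDynamics k L c B z R a D κ ν) : ¬ Summable a := fun ha => by
  obtain ⟨U, -, hU⟩ := h.R_bounded_of_summable ha
  obtain ⟨t, ht⟩ := (h.tendsto_R.eventually_gt_atTop U).exists
  exact absurd (hU t) (not_le.2 ht)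

/-- Because `slope z * z ≤ ν`, the factor `ν` cancels and the logarithm of the margin gains `L a (1
+ D)` up to the relative error `e`. It is used with `e = 1 / 2` and then with `e` of order `ℓ(z)
R^L`. -/
lemma log_z_increment (h : MarginDynamics k L c B z R a D κ ν) {t : ℕ} (hz : 2 ≤ z t) {e : ℝ}
    (he : e ≤ 1)
    (hd : (1 - e) * (L * ν t * a t * (1 + D t)) ≤ k.loss (z t) - k.loss (z (t + 1))) :
    Real.log (z t) + (1 - e) * (L * a t * (1 + D t)) ≤ Real.log (z (t + 1)) := by
  have h1 := k.loss_sub_loss_le_mul_log hz (h.z_le_succ t)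
  have h2 := h.le_ν t
  have ha := h.a_nonneg t
  have hD := h.D_nonneg t
  have hL := h.hL
  have hz0 := h.z_pos t
  have hs : 0 < k.slope (z t) * z t := mul_pos (k.slope_pos _) (h.z_pos t)
  have he' : 0 ≤ 1 - e := by linarith
  have h3 : k.slope (z t) * z t * ((1 - e) * (L * a t * (1 + D t))) ≤
      (1 - e) * (L * ν t * a t * (1 + D t)) := by
    calc _ = (1 - e) * (L * (k.slope (z t) * z t) * a t * (1 + D t)) := by ring
      _ ≤ _ := by gcongr
  linarith [le_of_mul_le_mul_left (h3.trans (hd.trans h1)) hs]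

/-- The squared norm grows at most polynomially in the margin. -/
lemma R_rpow_le (h : MarginDynamics k L c B z R a D κ ν) (hz : 2 ≤ z 0) :
    ∃ K, 0 < K ∧ ∀ t, R t ^ L ≤ K * z t ^ 4 := by
  have hL := h.hL
  -- The weight is `L / 4`, half of the natural `L / 2`, since with `e = 1 / 2` only half of the
  -- gain of `log z` is guaranteed.
  have hstep : ∀ t, (Real.log (z t) - L / 4 * Real.log (R t)) ≤
      (Real.log (z (t + 1)) - L / 4 * Real.log (R (t + 1))) + L / 4 * κ t := fun t => by
    have h1 := h.log_z_increment (t := t) (e := 1 / 2)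
      (hz.trans (h.z_monotone (Nat.zero_le t))) (by norm_num)
      (by have := h.descent t; linarith)
    have h2 := mul_le_mul_of_nonneg_left (h.log_R_le t) (show 0 ≤ L / 4 by positivity)
    have h3 : 0 ≤ L * a t * D t := by
      have := h.a_nonneg t
      have := h.D_nonneg t
      positivity
    linarith
  have h1 := le_of_le_add (fun t => mul_nonneg (by positivity) (h.κ_nonneg t))
    (h.summable_κ.mul_left _) hstep
  set A := Real.log (z 0) - L / 4 * Real.log (R 0) - ∑' i, L / 4 * κ i with hA
  refine ⟨Real.exp (-(4 * A)), Real.exp_pos _, fun t => ?_⟩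
  rw [← Real.log_le_log_iff (Real.rpow_pos_of_pos (h.R_pos t) _)
    (mul_pos (Real.exp_pos _) (pow_pos (h.z_pos t) _)), Real.log_rpow (h.R_pos t),
    Real.log_mul (Real.exp_pos _).ne' (pow_pos (h.z_pos t) _).ne', Real.log_exp, Real.log_pow]
  have := h1 t
  push_cast
  linarith

end MarginDynamics

lemma exists_pow_mul_exp_le (n : ℕ) {b : ℝ} (hb : 0 < b) :
    ∃ K, 0 < K ∧ ∀ x : ℝ, 0 ≤ x → x ^ n * Real.exp (-b * x) ≤ K := by
  refine ⟨(n.factorial : ℝ) / b ^ n, by positivity, fun x hx => ?_⟩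
  have h := Real.pow_div_factorial_le_exp (b * x) (by positivity) n
  rw [neg_mul, Real.exp_neg, ← div_eq_mul_inv, div_le_div_iff₀ (Real.exp_pos _) (by positivity)]
  rw [mul_pow, div_le_iff₀ (by positivity)] at h
  linarith

namespace MarginDynamics

variable {k : LossKind} {L c B : ℝ} {z R a D κ ν : ℕ → ℝ}

/-- The total second-order error is finite. -/
lemma summable_error (h : MarginDynamics k L c B z R a D κ ν) (hz : 2 ≤ z 0) :
    Summable fun t => a t * (k.loss (z t) * R t ^ L) := by
  have hL := h.hL
  obtain ⟨K, hK, hR⟩ := h.R_rpow_le hz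
  obtain ⟨K', hK', hexp⟩ := exists_pow_mul_exp_le 3 (show (0 : ℝ) < 1 / 2 by norm_num)
  -- Of the two factors `√ℓ` in `ℓ`, one telescopes and the other absorbs `z³`: this is the `z⁴`
  -- bounding `R^L`, less the factor `z` that the descent consumes.
  set s : ℕ → ℝ := fun t => Real.sqrt (k.loss (z t)) with hs
  have hs2 : ∀ t, s t ^ 2 = k.loss (z t) := fun t => Real.sq_sqrt (k.loss_pos _).le
  have hs0 : ∀ t, 0 < s t := fun t => Real.sqrt_pos.2 (k.loss_pos _)
  refine summable_of_add_le (Ψ := fun t => -(8 / L * K * K' * s t)) (κ := fun _ => 0) (U := 0)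
    (fun t => ?_) (fun _ => le_rfl) summable_zero (fun t => ?_) (fun t => ?_)
  · have := h.a_nonneg t
    have := k.loss_pos (z t)
    have := (h.R_pos t).le
    positivity
  · have hzt := h.z_pos t
    have hzR := hR t
    have ha := h.a_nonneg t
    have hD := h.D_nonneg t
    have hst := hs0 t
    have hlt := k.loss_pos (z t)
    have h1 : a t * k.loss (z t) * z t ≤ 4 / L * (s t ^ 2 - s (t + 1) ^ 2) := by
      rw [hs2, hs2, div_mul_eq_mul_div, le_div_iff₀ hL]
      have h2 := h.descent t
      have h3 := h.le_ν t
      have h4 := k.exp_le_two_mul_slope hzt.le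
      have h5 := k.loss_le_exp (z t)
      have h6 : k.loss (z t) / 2 * z t ≤ ν t := le_trans (by gcongr; linarith) h3
      have h7 : L * (k.loss (z t) / 2 * z t) * a t * 1 ≤ L * ν t * a t * (1 + D t) := by
        have := h.ν_pos t
        gcongr
        linarith
      linarith
    have hs1 : s (t + 1) ≤ s t :=
      Real.sqrt_le_sqrt (k.loss_strictAnti.antitone (h.z_le_succ t))
    have h8 : z t ^ 3 * s t ≤ K' := by
      refine le_trans ?_ (hexp (z t) hzt.le)
      gcongr
      rw [hs]
      simp only
      rw [show -(1 / 2) * z t = -(z t) / 2 by ring, Real.exp_half]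
      exact Real.sqrt_le_sqrt (k.loss_le_exp _)
    have h9 : s t ^ 2 - s (t + 1) ^ 2 ≤ 2 * s t * (s t - s (t + 1)) := by
      nlinarith [hs0 (t + 1)]
    have h10 : a t * (k.loss (z t) * R t ^ L) ≤ 8 / L * K * K' * (s t - s (t + 1)) := by
      calc a t * (k.loss (z t) * R t ^ L) ≤ a t * (k.loss (z t) * (K * z t ^ 4)) := by gcongr
        _ = K * z t ^ 3 * (a t * k.loss (z t) * z t) := by ring
        _ ≤ K * z t ^ 3 * (4 / L * (2 * s t * (s t - s (t + 1)))) := by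
            exact mul_le_mul_of_nonneg_left
              (h1.trans (mul_le_mul_of_nonneg_left h9 (by positivity))) (by positivity)
        _ = 8 / L * K * (z t ^ 3 * s t) * (s t - s (t + 1)) := by ring
        _ ≤ _ := by
            gcongr
    simp only [add_zero]
    linarith
  · have := hs0 t
    simp only [Left.neg_nonpos_iff]
    positivity

lemma tendsto_error (h : MarginDynamics k L c B z R a D κ ν) (hz : 2 ≤ z 0) :
    Tendsto (fun t => k.loss (z t) * R t ^ L) atTop (𝓝 0) := by
  obtain ⟨K, hK, hR⟩ := h.R_rpow_le hz
  -- Four powers for the bound on `R^L`, and a fifth to leave a factor `1 / z`.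
  obtain ⟨K', hK', hexp⟩ := exists_pow_mul_exp_le 5 (show (0 : ℝ) < 1 by norm_num)
  have h1 : Tendsto (fun t => K * K' / z t) atTop (𝓝 0) :=
    tendsto_const_nhds.div_atTop h.tendsto_z
  refine squeeze_zero (fun t => ?_) (fun t => ?_) h1
  · have := k.loss_pos (z t)
    have := (h.R_pos t).le
    positivity
  · have hzt := h.z_pos t
    have h2 := hexp (z t) hzt.le
    have h3 := k.loss_le_exp (z t)
    have h4 := hR t
    have h5 := (h.R_pos t).le
    rw [le_div_iff₀ hzt]
    calc k.loss (z t) * R t ^ L * z t ≤ Real.exp (-(z t)) * (K * z t ^ 4) * z t := by gcongr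
      _ = K * (z t ^ 5 * Real.exp (-1 * z t)) := by rw [neg_one_mul]; ring
      _ ≤ _ := by gcongr

/-- If the second-order error of the descent is of the order of the loss, then the normalized
margin stays bounded below and the deviation from alignment is summable. -/
theorem alignment (h : MarginDynamics k L c B z R a D κ ν) {C : ℝ} (hC : 0 ≤ C)
    (hd : ∀ᶠ t in atTop, (1 - C * (k.loss (z t) * R t ^ L)) * (L * ν t * a t * (1 + D t)) ≤
      k.loss (z t) - k.loss (z (t + 1))) :
    (Summable fun t => a t * D t) ∧ ∃ γ, 0 < γ ∧ ∀ᶠ t in atTop, γ * R t ^ (L / 2) ≤ z t := by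
  obtain ⟨T₁, hT₁⟩ := (h.tendsto_z.eventually_ge_atTop 2).exists
  have herr := ((h.shift T₁).tendsto_error (by simpa using hT₁)).const_mul C
  rw [mul_zero] at herr
  have herr' : Tendsto (fun t => C * (k.loss (z t) * R t ^ L)) atTop (𝓝 0) :=
    (tendsto_add_atTop_iff_nat T₁).1 herr
  obtain ⟨T, hT⟩ := eventually_atTop.1
    ((eventually_ge_atTop T₁).and (hd.and (herr'.eventually_le_const
      (show (0 : ℝ) < 1 / 2 by norm_num))))
  have hz2 : ∀ t, 2 ≤ z (t + T) := fun t => hT₁.trans (h.z_monotone (hT _ (by omega)).1)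
  have H := h.shift T
  have hL := h.hL
  have hB := h.hB
  have hsum := H.summable_error (by simpa using hz2 0)
  -- The first term is the part `e L a` lost to second order; the second is the error in `log R`
  -- with weight `L / 2`.
  set κ' : ℕ → ℝ := fun t => L * C * (a (t + T) * (k.loss (z (t + T)) * R (t + T) ^ L)) +
    L / 2 * κ (t + T) with hκ'
  have hκ'0 : ∀ t, 0 ≤ κ' t := fun t => by
    have := h.a_nonneg (t + T)
    have := k.loss_pos (z (t + T))
    have := (h.R_pos (t + T)).le
    have := h.κ_nonneg (t + T)
    simp only [hκ']
    positivity
  have hκ's : Summable κ' := (hsum.mul_left _).add (H.summable_κ.mul_left _)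
  -- With the exact weight `L / 2` the leading gains `L a` of both logarithms cancel. What remains
  -- is `(1 - e) L a D`, of which `e ≤ 1 / 2` preserves half.
  set Ψ : ℕ → ℝ := fun t => Real.log (z (t + T)) - L / 2 * Real.log (R (t + T)) with hΨ
  have hstep : ∀ t, Ψ t + L / 2 * (a (t + T) * D (t + T)) ≤ Ψ (t + 1) + κ' t := fun t => by
    obtain ⟨-, hd', he⟩ := hT (t + T) (by omega)
    have h1 := h.log_z_increment (hz2 t) (by linarith) hd'
    have h2 := mul_le_mul_of_nonneg_left (h.log_R_le (t + T)) (show 0 ≤ L / 2 by positivity)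
    have h3 : 0 ≤ L * (a (t + T) * D (t + T)) *
        (1 / 2 - C * (k.loss (z (t + T)) * R (t + T) ^ L)) := by
      have := h.a_nonneg (t + T)
      have := h.D_nonneg (t + T)
      have : 0 ≤ 1 / 2 - C * (k.loss (z (t + T)) * R (t + T) ^ L) := by linarith
      positivity
    simp only [hΨ, hκ', add_right_comm t 1 T]
    linarith
  have haD : ∀ t, 0 ≤ L / 2 * (a (t + T) * D (t + T)) := fun t => by
    have := h.a_nonneg (t + T)
    have := h.D_nonneg (t + T)
    positivity
  constructor
  · have h1 := summable_of_add_le (U := Real.log B) haD hκ'0 hκ's hstep fun t => by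
      have h2 := Real.log_le_log (h.z_pos (t + T)) (h.z_le (t + T))
      rw [Real.log_mul hB.ne' (Real.rpow_pos_of_pos (h.R_pos _) _).ne',
        Real.log_rpow (h.R_pos _)] at h2
      simp only [hΨ]
      linarith
    exact (summable_nat_add_iff (f := fun t => a t * D t) T).1
      ((summable_mul_left_iff (by positivity)).1 h1)
  · have h1 := le_of_le_add (Ψ := Ψ) hκ'0 hκ's fun t => by linarith [hstep t, haD t]
    refine ⟨Real.exp (Ψ 0 - ∑' i, κ' i), Real.exp_pos _, ?_⟩
    filter_upwards [eventually_ge_atTop T] with t ht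
    obtain ⟨n, rfl⟩ := Nat.exists_eq_add_of_le' ht
    have h2 := h1 n
    rw [← Real.log_le_log_iff (mul_pos (Real.exp_pos _) (Real.rpow_pos_of_pos (h.R_pos _) _))
      (h.z_pos _), Real.log_mul (Real.exp_pos _).ne' (Real.rpow_pos_of_pos (h.R_pos _) _).ne',
      Real.log_exp, Real.log_rpow (h.R_pos _)]
    simp only [hΨ] at h2 ⊢
    linarith

end MarginDynamics

/-! ### Reaching cluster points along times of small deviation. -/

/-- A cluster point of a sequence whose increments are dominated by `a` is approached along times
at which `D` tends to zero, provided that `∑ a = ∞` and `∑ a D < ∞`. -/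
theorem MapClusterPt.prodMk_zero_of_summable {E : Type*} [PseudoMetricSpace E] {u : ℕ → E}
    {a D : ℕ → ℝ} {C : ℝ} (ha : ∀ t, 0 ≤ a t) (hD : ∀ t, 0 ≤ D t) (hna : ¬ Summable a)
    (haD : Summable fun t => a t * D t)
    (hu : ∀ᶠ t in atTop, dist (u t) (u (t + 1)) ≤ C * a t) {x : E}
    (hx : MapClusterPt x atTop u) :
    MapClusterPt (x, (0 : ℝ)) atTop fun t => (u t, D t) := by
  wlog hC : 0 < C generalizing C
  · refine this (C := 1) ?_ one_pos
    filter_upwards [hu] with t ht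
    exact ht.trans (mul_le_mul_of_nonneg_right (by linarith) (ha t))
  rw [(Metric.nhds_basis_ball).mapClusterPt_iff_frequently]
  intro δ hδ
  by_contra hcon
  rw [not_frequently] at hcon
  -- From time `T` on, `D` is at least `δ` whenever `u` is within `δ` of `x`.
  obtain ⟨T, hT⟩ := eventually_atTop.1 (hcon.and hu)
  -- The threshold `δ * δ / (4 * C)` limits the total displacement to `δ / 4` as long as `D ≥ δ`.
  have htail := tendsto_sum_nat_add fun t => a t * D t
  have hev : ∀ᶠ t in atTop, ∑' i, (a (i + t) * D (i + t)) < δ * δ / (4 * C) :=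
    htail.eventually_lt_const (by positivity)
  obtain ⟨t₁, hxt, hsmall, htT⟩ :=
    ((hx.frequently (Metric.ball_mem_nhds x (half_pos hδ))).and_eventually
      (hev.and (eventually_ge_atTop T))).exists
  have hsum' : Summable fun i => a (i + t₁) * D (i + t₁) :=
    (summable_nat_add_iff (f := fun t => a t * D t) t₁).2 haD
  -- A trapping argument: a sequence starting within `δ / 2` of `x` never leaves the ball of radius
  -- `δ`, so `D ≥ δ` forever and `∑ a` is finite, a contradiction.
  have key : ∀ n, dist (u t₁) (u (n + t₁)) ≤ C * ∑ i ∈ Finset.range n, a (i + t₁) ∧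
      δ * ∑ i ∈ Finset.range n, a (i + t₁) ≤ δ * δ / (4 * C) := by
    intro n
    induction n using Nat.strong_induction_on with
    | _ n ih =>
      have hD' : ∀ i ∈ Finset.range n, δ * a (i + t₁) ≤ a (i + t₁) * D (i + t₁) := by
        intro i hi
        obtain ⟨ih1, ih2⟩ := ih i (Finset.mem_range.1 hi)
        have h1 := (hT (i + t₁) (by omega)).1
        have h2 : dist (u (i + t₁)) x < δ := by
          have h3 : C * ∑ j ∈ Finset.range i, a (j + t₁) ≤ δ / 4 := by
            rw [le_div_iff₀ (by positivity)] at ih2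
            have : δ * (C * ∑ j ∈ Finset.range i, a (j + t₁)) ≤ δ * (δ / 4) := by linarith
            exact le_of_mul_le_mul_left this hδ
          have h4 := dist_triangle_left (u (i + t₁)) x (u t₁)
          replace hxt : dist (u t₁) x < δ / 2 := hxt
          linarith
        have h5 : δ ≤ D (i + t₁) := by
          by_contra! hlt
          refine h1 ?_
          rw [Metric.mem_ball, Prod.dist_eq, max_lt_iff]
          refine ⟨h2, ?_⟩
          simp only [Real.dist_eq, sub_zero, abs_of_nonneg (hD _)]
          exact hlt
        rw [mul_comm]
        exact mul_le_mul_of_nonneg_left h5 (ha _)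
      constructor
      · cases n with
        | zero => simp
        | succ n =>
          have h1 := (ih n (Nat.lt_succ_self n)).1
          have h2 := (hT (n + t₁) (by omega)).2
          have h3 := dist_triangle (u t₁) (u (n + t₁)) (u (n + t₁ + 1))
          rw [Finset.sum_range_succ, show n + 1 + t₁ = n + t₁ + 1 by ring]
          linarith
      · rw [Finset.mul_sum]
        refine (Finset.sum_le_sum hD').trans (le_trans ?_ hsmall.le)
        exact hsum'.sum_le_tsum _ fun i _ => mul_nonneg (ha _) (hD _)
  refine hna ((summable_nat_add_iff t₁).1 (summable_of_sum_range_le (c := δ / (4 * C))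
    (fun i => ha _) fun n => ?_))
  refine le_of_mul_le_mul_left (a := δ) ?_ hδ
  rw [← mul_div_assoc]
  exact (key n).2

/-! ### Homogeneous functions: Euler's identity and scale-invariant bounds. -/

section Homogeneous

variable {F : Type*} [NormedAddCommGroup F] [InnerProductSpace ℝ F] [CompleteSpace F]
  {q : F → ℝ} {L : ℝ}

lemma HasGradientAt.hasDerivAt_comp_line {q : F → ℝ} {g w d : F} {s : ℝ}
    (h : HasGradientAt q g (w + s • d)) :
    HasDerivAt (fun s : ℝ => q (w + s • d)) (inner ℝ g d) s := by
  have h1 : HasDerivAt (fun s : ℝ => w + s • d) d s := by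
    simpa using ((hasDerivAt_id s).smul_const d).const_add w
  have h2 := h.hasFDerivAt.comp_hasDerivAt s h1
  rw [InnerProductSpace.toDual_apply_apply] at h2
  exact h2

/-- The gradient of a function that is homogeneous of degree `L` is homogeneous of degree
`L - 1`. -/
lemma gradient_smul_of_homogeneous (hq : Differentiable ℝ q)
    (hhom : ∀ α : ℝ, 0 < α → ∀ w, q (α • w) = α ^ L * q w) {α : ℝ} (hα : 0 < α) (w : F) :
    gradient q (α • w) = α ^ (L - 1) • gradient q w := by
  refine ext_inner_right ℝ fun v => ?_
  have h1 := (hq (α • w)).hasGradientAt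
  have h2 : HasDerivAt (fun s : ℝ => q (α • w + s • (α • v)))
      (inner ℝ (gradient q (α • w)) (α • v)) 0 :=
    HasGradientAt.hasDerivAt_comp_line (by simpa using h1)
  have h3 : HasDerivAt (fun s : ℝ => q (w + s • v)) (inner ℝ (gradient q w) v) 0 :=
    HasGradientAt.hasDerivAt_comp_line (by simpa using (hq w).hasGradientAt)
  have h4 : (fun s : ℝ => q (α • w + s • (α • v))) = fun s => α ^ L * q (w + s • v) := by
    funext s
    rw [← hhom α hα, smul_add, smul_comm α s]
  rw [h4] at h2
  have h5 := h2.unique (h3.const_mul (α ^ L))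
  rw [real_inner_smul_right] at h5
  rw [real_inner_smul_left, Real.rpow_sub_one hα.ne', div_mul_eq_mul_div, eq_div_iff hα.ne', ← h5]
  ring

/-- Euler's identity for homogeneous functions. -/
lemma inner_gradient_self_of_homogeneous (hq : Differentiable ℝ q)
    (hhom : ∀ α : ℝ, 0 < α → ∀ w, q (α • w) = α ^ L * q w) (w : F) :
    inner ℝ (gradient q w) w = L * q w := by
  have h1 : HasDerivAt (fun s : ℝ => q (0 + s • w)) (inner ℝ (gradient q w) w) 1 :=
    HasGradientAt.hasDerivAt_comp_line (by simpa using (hq w).hasGradientAt)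
  have h2 : HasDerivAt (fun s : ℝ => s ^ L * q w) (L * 1 ^ (L - 1) * q w) 1 :=
    (Real.hasDerivAt_rpow_const (Or.inl one_ne_zero)).mul_const _
  have h3 : (fun s : ℝ => q (0 + s • w)) =ᶠ[𝓝 1] fun s : ℝ => s ^ L * q w := by
    filter_upwards [eventually_gt_nhds (zero_lt_one (α := ℝ))] with s hs
    rw [zero_add, hhom s hs]
  have := h1.unique (h2.congr_of_eventuallyEq h3)
  simpa using this

/-- Scale-invariant bounds for a homogeneous function, its gradient, and its first-order
expansion. -/
structure HomogeneousBounds (q : F → ℝ) (L B : ℝ) : Prop where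
  abs_le : ∀ w, w ≠ 0 → |q w| ≤ B * ‖w‖ ^ L
  norm_gradient_le : ∀ w, w ≠ 0 → ‖gradient q w‖ ≤ B * ‖w‖ ^ (L - 1)
  taylor : ∀ w, w ≠ 0 → ∀ d, ‖d‖ ≤ ‖w‖ →
    |q (w + d) - q w - inner ℝ (gradient q w) d| ≤ B * ‖w‖ ^ (L - 2) * ‖d‖ ^ 2

lemma HomogeneousBounds.mono {B B' : ℝ} (h : HomogeneousBounds q L B) (hB : B ≤ B') :
    HomogeneousBounds q L B' where
  abs_le w hw := (h.abs_le w hw).trans (by gcongr)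
  norm_gradient_le w hw := (h.norm_gradient_le w hw).trans (by gcongr)
  taylor w hw d hd := (h.taylor w hw d hd).trans (by gcongr)

lemma abs_sub_inner_gradient_le {K : NNReal} (hq : Differentiable ℝ q) {r : ℝ}
    (hK : LipschitzOnWith K (gradient q) (Metric.closedBall 0 r)) {u d : F}
    (hr : ‖u‖ + ‖d‖ ≤ r) :
    |q (u + d) - q u - inner ℝ (gradient q u) d| ≤ K * ‖d‖ ^ 2 := by
  have h := Convex.norm_image_sub_le_of_norm_fderiv_le' (𝕜 := ℝ) (f := q) (φ := fderiv ℝ q u)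
    (C := K * ‖d‖) (s := Metric.closedBall u ‖d‖) (x := u) (y := u + d) (fun x _ => hq x)
    (fun x hx => by
      rw [mem_closedBall_iff_norm] at hx
      rw [← toDual_gradient, ← toDual_gradient, ← map_sub, LinearIsometryEquiv.norm_map]
      refine (hK.norm_sub_le ?_ ?_).trans (by gcongr)
      · rw [mem_closedBall_zero_iff]
        have := norm_le_norm_add_norm_sub' x u
        linarith
      · rw [mem_closedBall_zero_iff]
        linarith [norm_nonneg d])
    (convex_closedBall _ _) (Metric.mem_closedBall_self (norm_nonneg _)) (by simp)
  rw [add_sub_cancel_left, Real.norm_eq_abs, ← inner_gradient_left] at h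
  linarith

theorem exists_homogeneousBounds [FiniteDimensional ℝ F] (hq : Differentiable ℝ q)
    (hlip : LocallyLipschitz (gradient q))
    (hhom : ∀ α : ℝ, 0 < α → ∀ w, q (α • w) = α ^ L * q w) :
    ∃ B, 0 < B ∧ HomogeneousBounds q L B := by
  -- After rescaling, the base point has norm `1` and the displacement norm at most `1`, so the ball
  -- of radius `2` contains all segments involved.
  have hcomp : IsCompact (Metric.closedBall (0 : F) 2) := isCompact_closedBall 0 2
  obtain ⟨K, hK⟩ := (hlip.locallyLipschitzOn (s := Metric.closedBall 0 2)).exists_lipschitzOnWith_of_compact hcomp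
  obtain ⟨B₁, hB₁⟩ := hcomp.exists_bound_of_continuousOn hq.continuous.continuousOn
  obtain ⟨B₂, hB₂⟩ := hcomp.exists_bound_of_continuousOn hlip.continuous.continuousOn
  have hscale : ∀ w : F, w ≠ 0 → ∃ u : F, ‖u‖ = 1 ∧ w = ‖w‖ • u := fun w hw => by
    have := norm_pos_iff.2 hw
    exact ⟨‖w‖⁻¹ • w, by rw [norm_smul, norm_inv, norm_norm, inv_mul_cancel₀ this.ne'],
      by rw [smul_smul, mul_inv_cancel₀ this.ne', one_smul]⟩
  have hB : 0 ≤ max (max B₁ B₂) (K : ℝ) := le_trans K.2 (le_max_right _ _)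
  refine ⟨max (max B₁ B₂) K + 1, by linarith, HomogeneousBounds.mono (B := max (max B₁ B₂) K)
    ⟨fun w hw => ?_, fun w hw => ?_, fun w hw d hd => ?_⟩ (by linarith)⟩ <;>
  obtain ⟨u, hu, hwu⟩ := hscale w hw <;>
  have hw0 := norm_pos_iff.2 hw <;>
  set r := ‖w‖ with hr <;>
  have humem : u ∈ Metric.closedBall (0 : F) 2 := by
    rw [mem_closedBall_zero_iff, hu]; norm_num
  · rw [hwu, hhom r hw0, abs_mul, abs_of_pos (Real.rpow_pos_of_pos hw0 _), mul_comm]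
    have h1 : |q u| ≤ max (max B₁ B₂) K :=
      (hB₁ u humem).trans ((le_max_left _ _).trans (le_max_left _ _))
    gcongr
  · rw [hwu, gradient_smul_of_homogeneous hq hhom hw0, norm_smul,
      Real.norm_of_nonneg (Real.rpow_pos_of_pos hw0 _).le, mul_comm]
    have h1 : ‖gradient q u‖ ≤ max (max B₁ B₂) K :=
      (hB₂ u humem).trans ((le_max_right _ _).trans (le_max_left _ _))
    gcongr
  · obtain ⟨e, rfl⟩ : ∃ e, d = r • e :=
      ⟨r⁻¹ • d, by rw [smul_smul, mul_inv_cancel₀ hw0.ne', one_smul]⟩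
    rw [norm_smul, Real.norm_of_nonneg hw0.le] at hd ⊢
    have he : ‖e‖ ≤ 1 := by
      by_contra! h
      nlinarith
    have h1 := abs_sub_inner_gradient_le hq hK (u := u) (d := e) (by linarith)
    have h2 : (K : ℝ) ≤ max (max B₁ B₂) K := le_max_right _ _
    have h3 : r ^ L = r ^ (L - 2) * r ^ 2 := by
      rw [← Real.rpow_natCast r 2, ← Real.rpow_add hw0]
      norm_num
    have h4 : r ^ (L - 1) * r = r ^ L := by
      rw [← Real.rpow_add_one hw0.ne']
      norm_num
    have h5 : q (w + r • e) - q w - inner ℝ (gradient q w) (r • e) =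
        r ^ L * (q (u + e) - q u - inner ℝ (gradient q u) e) := by
      rw [hwu, ← smul_add, hhom r hw0, hhom r hw0, gradient_smul_of_homogeneous hq hhom hw0,
        real_inner_smul_left, real_inner_smul_right, ← h4]
      ring
    have hp := Real.rpow_pos_of_pos hw0 L
    rw [h5, abs_mul, abs_of_pos hp]
    calc r ^ L * |q (u + e) - q u - inner ℝ (gradient q u) e|
        ≤ r ^ L * (max (max B₁ B₂) K * ‖e‖ ^ 2) := by
          gcongr
          exact h1.trans (by gcongr)
      _ = _ := by rw [h3]; ring

end Homogeneous

/-! ### Descent along a ray inside a sublevel set. -/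

/-- The descent lemma for a function whose gradient is Lipschitz on a sublevel set. -/
lemma le_of_hasDerivAt_of_sublevel {φ φ' : ℝ → ℝ} {A K η : ℝ} (hA : 0 < A) (hη : 0 ≤ η)
    (hKη : K * η ≤ A) (hK : 0 ≤ K) (hφ : ∀ s, HasDerivAt φ (φ' s) s)
    (hlip : ∀ s, 0 ≤ s → φ s ≤ φ 0 → φ' s ≤ -A + K * s) :
    φ η ≤ φ 0 - η * A / 2 := by
  -- The slack `δ` provides the strict inequality of derivatives that the comparison principle
  -- needs. Since `δ ≤ A / 2`, the majorant stays below `φ 0`, so any contact point lies in the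
  -- sublevel set and `hlip` applies there; no convexity of that set is needed. Finally `δ → 0`.
  have main : ∀ δ, 0 < δ → δ ≤ A / 2 → φ η ≤ φ 0 - A * η + K * η ^ 2 / 2 + δ * η := by
    intro δ hδ hδA
    have h := image_le_of_deriv_right_lt_deriv_boundary (f := φ) (f' := φ') (a := 0) (b := η)
      (B := fun s => φ 0 - A * s + K * s ^ 2 / 2 + δ * s) (B' := fun s => -A + K * s + δ)
      (fun s _ => (hφ s).continuousAt.continuousWithinAt)
      (fun s _ => (hφ s).hasDerivWithinAt) (by simp)
      (fun s => by
        have h1 := (((hasDerivAt_id s).const_mul A).const_sub (φ 0)).add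
          ((((hasDerivAt_id s).pow 2).const_mul K).div_const 2)
        refine (h1.add ((hasDerivAt_id s).const_mul δ)).congr_deriv ?_
        simp only [id, Nat.cast_ofNat]
        ring)
      (fun s hs hsB => by
        have h2 := hlip s hs.1 (by
          rw [hsB]
          have h3 : K * s ≤ A := le_trans (mul_le_mul_of_nonneg_left hs.2.le hK) hKη
          nlinarith [hs.1])
        linarith)
    exact h (Set.right_mem_Icc.2 hη)
  have h1 : Tendsto (fun δ => φ 0 - A * η + K * η ^ 2 / 2 + δ * η) (𝓝[>] 0)
      (𝓝 (φ 0 - A * η + K * η ^ 2 / 2 + 0 * η)) :=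
    ((continuous_const.add (continuous_id.mul continuous_const)).tendsto 0).mono_left
      nhdsWithin_le_nhds
  have h2 := ge_of_tendsto h1 (by
    filter_upwards [self_mem_nhdsWithin, nhdsWithin_le_nhds (eventually_le_nhds (half_pos hA))]
      with δ hδ hδA using main δ hδ hδA)
  nlinarith

/-! ### AdaGrad in the metric of its conditioner. -/

section AdaGrad

variable {p : ℕ} {ε : ℝ} {F : EuclideanSpace ℝ (Fin p) → ℝ} {η : ℕ → ℝ}
  {w : ℕ → EuclideanSpace ℝ (Fin p)}

lemma adaGradConditioner_apply (t : ℕ) (j : Fin p) : adaGradConditioner ε F w t j =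
    (Real.sqrt (ε + ∑ τ ∈ Finset.range (t + 1), (gradient F (w τ) j) ^ 2))⁻¹ := rfl

lemma hadamardVec_apply (a b : EuclideanSpace ℝ (Fin p)) (j : Fin p) :
    hadamardVec a b j = a j * b j := rfl

lemma powVec_apply (a : EuclideanSpace ℝ (Fin p)) (s : ℝ) (j : Fin p) :
    powVec a s j = a j ^ s := rfl

lemma adaGradConditioner_pos (hε : 0 < ε) (t : ℕ) (j : Fin p) :
    0 < adaGradConditioner ε F w t j := by
  rw [adaGradConditioner_apply, inv_pos, Real.sqrt_pos]
  positivity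

lemma sqrt_le_inv_adaGradConditioner (t : ℕ) (j : Fin p) :
    Real.sqrt ε ≤ (adaGradConditioner ε F w t j)⁻¹ := by
  rw [adaGradConditioner_apply, inv_inv]
  exact Real.sqrt_le_sqrt (le_add_of_nonneg_right (by positivity))

lemma adaGradConditioner_le (hε : 0 < ε) (t : ℕ) (j : Fin p) :
    adaGradConditioner ε F w t j ≤ (Real.sqrt ε)⁻¹ := by
  have := inv_anti₀ (Real.sqrt_pos.2 hε) (sqrt_le_inv_adaGradConditioner (F := F) (w := w) t j)
  rwa [inv_inv] at this

lemma adaGradConditioner_antitone (hε : 0 < ε) (j : Fin p) :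
    Antitone fun t => adaGradConditioner ε F w t j := by
  refine antitone_nat_of_succ_le fun t => ?_
  simp only [adaGradConditioner_apply]
  refine inv_anti₀ (Real.sqrt_pos.2 (by positivity)) (Real.sqrt_le_sqrt ?_)
  rw [Finset.sum_range_succ _ (t + 1), ← add_assoc]
  exact le_add_of_nonneg_right (sq_nonneg _)

/-- The squared gradient norm `∑ h_j (∂_j F)²` of an AdaGrad run, in the metric of the
conditioner. -/
noncomputable def adaGradDecrement (ε : ℝ) (F : EuclideanSpace ℝ (Fin p) → ℝ)
    (w : ℕ → EuclideanSpace ℝ (Fin p)) (t : ℕ) : ℝ :=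
  ∑ j, adaGradConditioner ε F w t j * gradient F (w t) j ^ 2

/-- The squared norm `∑ h_j⁻¹ w_j²` of an AdaGrad iterate, in the metric of the conditioner. -/
noncomputable def adaGradSqNorm (ε : ℝ) (F : EuclideanSpace ℝ (Fin p) → ℝ)
    (w : ℕ → EuclideanSpace ℝ (Fin p)) (t : ℕ) : ℝ :=
  ∑ j, (adaGradConditioner ε F w t j)⁻¹ * w t j ^ 2

lemma adaGradDecrement_nonneg (hε : 0 < ε) (t : ℕ) : 0 ≤ adaGradDecrement ε F w t :=
  Finset.sum_nonneg fun j _ => mul_nonneg (adaGradConditioner_pos hε t j).le (sq_nonneg _)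

lemma inner_hadamardVec_gradient (t : ℕ) :
    inner ℝ (gradient F (w t)) (hadamardVec (adaGradConditioner ε F w t) (gradient F (w t))) =
      adaGradDecrement ε F w t := by
  simp only [PiLp.inner_apply, hadamardVec_apply, adaGradDecrement, RCLike.inner_apply,
    conj_trivial]
  exact Finset.sum_congr rfl fun j _ => by ring

lemma norm_sq_hadamardVec_gradient (t : ℕ) :
    ‖hadamardVec (adaGradConditioner ε F w t) (gradient F (w t))‖ ^ 2 =
      ∑ j, adaGradConditioner ε F w t j *
        (adaGradConditioner ε F w t j * gradient F (w t) j ^ 2) := by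
  rw [EuclideanSpace.real_norm_sq_eq]
  exact Finset.sum_congr rfl fun j _ => by rw [hadamardVec_apply]; ring

lemma mul_norm_sq_hadamardVec_gradient_le (hε : 0 < ε) {t : ℕ} {C : ℝ}
    (hC : ∀ j, C * adaGradConditioner ε F w t j ≤ 1) :
    C * ‖hadamardVec (adaGradConditioner ε F w t) (gradient F (w t))‖ ^ 2 ≤
      adaGradDecrement ε F w t := by
  rw [norm_sq_hadamardVec_gradient, Finset.mul_sum]
  refine Finset.sum_le_sum fun j _ => ?_
  rw [← mul_assoc]
  exact mul_le_of_le_one_left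
    (mul_nonneg (adaGradConditioner_pos hε t j).le (sq_nonneg _)) (hC j)

lemma IsAdaGradRun.succ_eq (hrun : IsAdaGradRun ε F η w) (t : ℕ) :
    w (t + 1) = w t +
      η t • (-hadamardVec (adaGradConditioner ε F w t) (gradient F (w t))) := by
  rw [smul_neg, ← hrun t, add_sub_cancel]

lemma IsAdaGradRun.norm_sub_sq_le (hε : 0 < ε) (hrun : IsAdaGradRun ε F η w) (t : ℕ) :
    ‖w (t + 1) - w t‖ ^ 2 ≤ η t ^ 2 * ((Real.sqrt ε)⁻¹ * adaGradDecrement ε F w t) := by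
  have hs := Real.sqrt_pos.2 hε
  rw [hrun t, norm_neg, norm_smul, mul_pow, Real.norm_eq_abs, sq_abs]
  gcongr
  rw [← div_eq_inv_mul, le_div_iff₀' hs]
  refine mul_norm_sq_hadamardVec_gradient_le hε fun j => ?_
  rw [← le_div_iff₀' hs, one_div]
  exact adaGradConditioner_le hε t j

/-- One step of AdaGrad decreases a function that is smooth on a sublevel set. -/
lemma IsAdaGradRun.le_sub (hε : 0 < ε) (hrun : IsAdaGradRun ε F η w)
    (hF : Differentiable ℝ F) {M b : ℝ} (hM : 0 ≤ M) (hsmooth : IsSmoothOnWith M F {u | F u ≤ b})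
    {t : ℕ} (ht : F (w t) ≤ b) (hη : 0 ≤ η t)
    (hηM : ∀ j, M * η t * adaGradConditioner ε F w t j ≤ 1) :
    F (w (t + 1)) ≤ F (w t) - η t * adaGradDecrement ε F w t / 2 := by
  rw [hrun.succ_eq]
  set v := hadamardVec (adaGradConditioner ε F w t) (gradient F (w t)) with hv
  -- A zero decrement forces a zero step, because every `h_j` is positive; the ray lemma covers
  -- positive decrements only.
  rcases (adaGradDecrement_nonneg (F := F) (w := w) hε t).eq_or_lt with h0 | h0
  · have hv0 : v = 0 := by
      ext j
      have h1 := (Finset.sum_eq_zero_iff_of_nonneg fun j _ =>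
        mul_nonneg (adaGradConditioner_pos hε t j).le (sq_nonneg _)).1 h0.symm j (Finset.mem_univ j)
      have h2 := (mul_eq_zero.1 h1).resolve_left (adaGradConditioner_pos hε t j).ne'
      rw [hv, hadamardVec_apply, pow_eq_zero_iff two_ne_zero |>.1 h2, mul_zero]
      rfl
    simp [← h0, hv0]
  · have h := le_of_hasDerivAt_of_sublevel (φ := fun s => F (w t + s • (-v)))
      (φ' := fun s => inner ℝ (gradient F (w t + s • (-v))) (-v))
      (A := adaGradDecrement ε F w t) (K := M * ‖v‖ ^ 2) (η := η t) h0 hη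
      (by
        have := mul_norm_sq_hadamardVec_gradient_le hε hηM
        rw [← hv] at this
        linarith) (by positivity)
      (fun s => HasGradientAt.hasDerivAt_comp_line (hF _).hasGradientAt)
      (fun s hs hle => by
        simp only [zero_smul, add_zero] at hle
        have h1 := hsmooth.2 _ (show _ ∈ {u | F u ≤ b} from hle.trans ht) _ ht
        have h2 : inner ℝ (gradient F (w t)) (-v) = -adaGradDecrement ε F w t := by
          rw [inner_neg_right, hv, inner_hadamardVec_gradient]
        have h3 := real_inner_le_norm (gradient F (w t + s • (-v)) - gradient F (w t)) (-v)
        rw [inner_sub_left, h2, norm_neg] at h3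
        rw [add_sub_cancel_left, norm_smul, norm_neg, Real.norm_of_nonneg hs] at h1
        nlinarith [mul_le_mul_of_nonneg_right h1 (norm_nonneg v)])
    simpa using h

/-- The iterates stay in the sublevel set. -/
lemma IsAdaGradRun.forall_le_sub (hε : 0 < ε) (hrun : IsAdaGradRun ε F η w)
    (hF : Differentiable ℝ F) {M : ℝ} (hM : 0 ≤ M) {t₀ : ℕ}
    (hsmooth : IsSmoothOnWith M F {u | F u ≤ F (w t₀)}) (hη : ∀ t, t₀ ≤ t → 0 ≤ η t)
    (hηM : ∀ t, t₀ ≤ t → ∀ j, M * η t * adaGradConditioner ε F w t j ≤ 1) {t : ℕ} (ht : t₀ ≤ t) :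
    F (w (t + 1)) ≤ F (w t) - η t * adaGradDecrement ε F w t / 2 := by
  have key : F (w t) ≤ F (w t₀) := by
    induction t, ht using Nat.le_induction with
    | base => exact le_rfl
    | succ t ht ih =>
      have h1 := hrun.le_sub hε hF hM hsmooth ih (hη t ht) (hηM t ht)
      have h2 := mul_nonneg (hη t ht) (adaGradDecrement_nonneg (F := F) (w := w) hε t)
      linarith
  exact hrun.le_sub hε hF hM hsmooth key (hη t ht) (hηM t ht)

lemma summable_adaGradDecrement (hε : 0 < ε) {t₀ : ℕ} {c : ℝ} (hc : 0 < c) (hF0 : ∀ u, 0 ≤ F u)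
    (hdec : ∀ t, t₀ ≤ t → F (w (t + 1)) ≤ F (w t) - c * adaGradDecrement ε F w t) :
    Summable (adaGradDecrement ε F w) := by
  refine (summable_nat_add_iff t₀).1 ((summable_mul_left_iff hc.ne').1
    (summable_of_add_le (Ψ := fun t => -F (w (t + t₀))) (κ := fun _ => 0) (U := 0)
    (fun t => mul_nonneg hc.le (adaGradDecrement_nonneg hε _)) (fun _ => le_rfl) summable_zero
    (fun t => ?_) (fun t => by linarith [hF0 (w (t + t₀))])))
  have := hdec (t + t₀) (by omega)
  rw [add_right_comm t 1 t₀]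
  linarith

/-- If the decrements are summable, then the conditioner converges to a positive limit. -/
lemma exists_tendsto_adaGradConditioner (hε : 0 < ε) (hsum : Summable (adaGradDecrement ε F w)) :
    ∃ hinf : EuclideanSpace ℝ (Fin p),
      Tendsto (adaGradConditioner ε F w) atTop (𝓝 hinf) ∧ (∀ j, 0 < hinf j) ∧
        ∀ t j, hinf j ≤ adaGradConditioner ε F w t j := by
  have hsumj : ∀ j, Summable fun t => adaGradConditioner ε F w t j * gradient F (w t) j ^ 2 :=
    fun j => hsum.of_nonneg_of_le
      (fun t => mul_nonneg (adaGradConditioner_pos hε t j).le (sq_nonneg _))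
      (fun t => Finset.single_le_sum
        (f := fun j => adaGradConditioner ε F w t j * gradient F (w t) j ^ 2)
        (fun j _ => mul_nonneg (adaGradConditioner_pos hε t j).le (sq_nonneg _))
        (Finset.mem_univ j))
  have hlow : ∀ j, ∃ b, 0 < b ∧ ∀ t, b ≤ adaGradConditioner ε F w t j := by
    intro j
    set c₀ := ∑' t, adaGradConditioner ε F w t j * gradient F (w t) j ^ 2
    -- As `h` decreases, its last value may be pulled out of the sum: `S / √(ε + S) ≤ c₀`. Then `S²
    -- ≤ (ε + S) c₀²`, which forces `S ≤ c₀² + ε`.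
    refine ⟨(Real.sqrt (ε + (c₀ ^ 2 + ε)))⁻¹, by positivity, fun t => ?_⟩
    set S := ∑ τ ∈ Finset.range (t + 1), gradient F (w τ) j ^ 2 with hS
    have hS0 : 0 ≤ S := by positivity
    have hsq : 0 < Real.sqrt (ε + S) := Real.sqrt_pos.2 (by positivity)
    rw [adaGradConditioner_apply]
    refine inv_anti₀ hsq (Real.sqrt_le_sqrt ?_)
    gcongr
    have h1 : (Real.sqrt (ε + S))⁻¹ * S ≤ c₀ := by
      rw [hS, Finset.mul_sum]
      refine le_trans (Finset.sum_le_sum fun τ hτ => ?_) ((hsumj j).sum_le_tsum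
        (Finset.range (t + 1))
        fun τ _ => mul_nonneg (adaGradConditioner_pos hε τ j).le (sq_nonneg _))
      have := adaGradConditioner_antitone (F := F) (w := w) hε j
        (Nat.lt_succ_iff.1 (Finset.mem_range.1 hτ))
      simp only at this
      rw [adaGradConditioner_apply (t := t), ← hS] at this
      gcongr
    rw [inv_mul_le_iff₀ hsq] at h1
    have h2 : S ^ 2 ≤ (ε + S) * c₀ ^ 2 := by
      rw [← Real.sq_sqrt (show 0 ≤ ε + S by positivity), ← mul_pow]
      gcongr
    by_contra! h3
    nlinarith [sq_nonneg c₀]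
  choose b hb0 hb using hlow
  refine ⟨WithLp.toLp 2 fun j => ⨅ t, adaGradConditioner ε F w t j, ?_, fun j => ?_,
    fun t j => ?_⟩
  · have h1 : Tendsto (fun t j => adaGradConditioner ε F w t j) atTop
        (𝓝 fun j => ⨅ t, adaGradConditioner ε F w t j) :=
      tendsto_pi_nhds.2 fun j => tendsto_atTop_ciInf (adaGradConditioner_antitone hε j)
        ⟨b j, by rintro _ ⟨t, rfl⟩; exact hb j t⟩
    exact ((PiLp.continuous_toLp 2 _).tendsto _).comp h1
  · exact (hb0 j).trans_le (le_ciInf (hb j))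
  · exact ciInf_le ⟨b j, by rintro _ ⟨t, rfl⟩; exact hb j t⟩ t

/-- Cauchy–Schwarz for the dual weights `h` and `h⁻¹`; this is what makes the deviation
non-negative. -/
lemma inner_gradient_sq_le (hε : 0 < ε) (t : ℕ) :
    (inner ℝ (gradient F (w t)) (w t)) ^ 2 ≤
      adaGradDecrement ε F w t * adaGradSqNorm ε F w t := by
  simp only [PiLp.inner_apply, RCLike.inner_apply, conj_trivial]
  refine Finset.sum_sq_le_sum_mul_sum_of_sq_le_mul _ (fun j _ => ?_) (fun j _ => ?_)
    (fun j _ => ?_)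
  · exact mul_nonneg (adaGradConditioner_pos hε t j).le (sq_nonneg _)
  · exact mul_nonneg (inv_pos.2 (adaGradConditioner_pos hε t j)).le (sq_nonneg _)
  · have := (adaGradConditioner_pos (F := F) (w := w) hε t j).ne'
    refine le_of_eq ?_
    field_simp

/-- The relative growth of the metric of the conditioner in one step. -/
noncomputable def adaGradGrowth (ε : ℝ) (F : EuclideanSpace ℝ (Fin p) → ℝ)
    (w : ℕ → EuclideanSpace ℝ (Fin p)) (t : ℕ) : ℝ :=
  (Real.sqrt ε)⁻¹ * ∑ j, ((adaGradConditioner ε F w (t + 1) j)⁻¹ -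
    (adaGradConditioner ε F w t j)⁻¹)

lemma inv_adaGradConditioner_le_succ (hε : 0 < ε) (t : ℕ) (j : Fin p) :
    (adaGradConditioner ε F w t j)⁻¹ ≤ (adaGradConditioner ε F w (t + 1) j)⁻¹ :=
  inv_anti₀ (adaGradConditioner_pos hε _ j)
    (adaGradConditioner_antitone (F := F) (w := w) hε j (Nat.le_succ t))

lemma adaGradGrowth_nonneg (hε : 0 < ε) (t : ℕ) : 0 ≤ adaGradGrowth ε F w t :=
  mul_nonneg (by positivity) (Finset.sum_nonneg fun j _ =>
    sub_nonneg.2 (inv_adaGradConditioner_le_succ hε t j))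

/-- Since `h_j⁻¹ ≥ √ε`, absolute increments are also relative ones. Summing over the coordinates
gives one factor valid for all of them. -/
lemma inv_adaGradConditioner_succ_le (hε : 0 < ε) (t : ℕ) (j : Fin p) :
    (adaGradConditioner ε F w (t + 1) j)⁻¹ ≤
      (1 + adaGradGrowth ε F w t) * (adaGradConditioner ε F w t j)⁻¹ := by
  have hs := Real.sqrt_pos.2 hε
  have h1 := Finset.single_le_sum
    (f := fun j => (adaGradConditioner ε F w (t + 1) j)⁻¹ - (adaGradConditioner ε F w t j)⁻¹)
    (fun j _ => sub_nonneg.2 (inv_adaGradConditioner_le_succ (F := F) (w := w) hε t j))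
    (Finset.mem_univ j)
  have h2 : Real.sqrt ε * adaGradGrowth ε F w t = ∑ j, ((adaGradConditioner ε F w (t + 1) j)⁻¹ -
      (adaGradConditioner ε F w t j)⁻¹) := by
    rw [adaGradGrowth, ← mul_assoc, mul_inv_cancel₀ hs.ne', one_mul]
  have h3 := mul_le_mul_of_nonneg_right (sqrt_le_inv_adaGradConditioner (F := F) (ε := ε) (w := w)
    t j) (adaGradGrowth_nonneg (F := F) (w := w) hε t)
  simp only at h1
  linarith

/-- The growths telescope to `∑ h_j⁻¹`, which is bounded by `∑ hinf_j⁻¹`. -/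
lemma summable_adaGradGrowth (hε : 0 < ε) {hinf : EuclideanSpace ℝ (Fin p)}
    (hpos : ∀ j, 0 < hinf j) (hle : ∀ t j, hinf j ≤ adaGradConditioner ε F w t j) :
    Summable (adaGradGrowth ε F w) := by
  refine summable_of_add_le
    (Ψ := fun t => (Real.sqrt ε)⁻¹ * ∑ j, (adaGradConditioner ε F w t j)⁻¹) (κ := fun _ => 0)
    (U := (Real.sqrt ε)⁻¹ * ∑ j, (hinf j)⁻¹)
    (adaGradGrowth_nonneg hε) (fun _ => le_rfl) summable_zero (fun t => ?_) (fun t => ?_)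
  · rw [adaGradGrowth, Finset.sum_sub_distrib]
    simp only [add_zero]
    linarith
  · gcongr with j
    exacts [hpos j, hle t j]

/-- In the old metric the step expands exactly: `h⁻¹` cancels the `h` of the update, leaving the
plain inner product and the decrement. Passing to the new metric costs the factor in front. -/
lemma IsAdaGradRun.sqNorm_succ_le (hε : 0 < ε) (hrun : IsAdaGradRun ε F η w) (t : ℕ) :
    adaGradSqNorm ε F w (t + 1) ≤ (1 + adaGradGrowth ε F w t) * (adaGradSqNorm ε F w t -
      2 * η t * inner ℝ (gradient F (w t)) (w t) + η t ^ 2 * adaGradDecrement ε F w t) := by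
  have h1 : adaGradSqNorm ε F w t - 2 * η t * inner ℝ (gradient F (w t)) (w t) +
      η t ^ 2 * adaGradDecrement ε F w t =
      ∑ j, (adaGradConditioner ε F w t j)⁻¹ * w (t + 1) j ^ 2 := by
    simp only [adaGradSqNorm, adaGradDecrement, PiLp.inner_apply, RCLike.inner_apply,
      conj_trivial, Finset.mul_sum, ← Finset.sum_sub_distrib, ← Finset.sum_add_distrib]
    refine Finset.sum_congr rfl fun j _ => ?_
    have h2 : w (t + 1) j = w t j - η t * (adaGradConditioner ε F w t j * gradient F (w t) j) := by
      rw [hrun.succ_eq]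
      simp [hadamardVec_apply, sub_eq_add_neg]
    rw [h2]
    have := (adaGradConditioner_pos (F := F) (w := w) hε t j).ne'
    field_simp
    ring
  rw [h1, Finset.mul_sum]
  refine Finset.sum_le_sum fun j _ => ?_
  rw [← mul_assoc]
  exact mul_le_mul_of_nonneg_right (inv_adaGradConditioner_succ_le hε t j) (sq_nonneg _)

lemma sqrt_mul_norm_sq_le_adaGradSqNorm (t : ℕ) :
    Real.sqrt ε * ‖w t‖ ^ 2 ≤ adaGradSqNorm ε F w t := by
  rw [EuclideanSpace.real_norm_sq_eq, Finset.mul_sum]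
  exact Finset.sum_le_sum fun j _ =>
    mul_le_mul_of_nonneg_right (sqrt_le_inv_adaGradConditioner t j) (sq_nonneg _)

lemma adaGradSqNorm_le {hinf : EuclideanSpace ℝ (Fin p)}
    (hpos : ∀ j, 0 < hinf j) (hle : ∀ t j, hinf j ≤ adaGradConditioner ε F w t j) (t : ℕ) :
    adaGradSqNorm ε F w t ≤ (∑ j, (hinf j)⁻¹) * ‖w t‖ ^ 2 := by
  rw [EuclideanSpace.real_norm_sq_eq, Finset.mul_sum]
  refine Finset.sum_le_sum fun j _ => mul_le_mul_of_nonneg_right ?_ (sq_nonneg _)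
  exact (inv_anti₀ (hpos j) (hle t j)).trans
    (Finset.single_le_sum (f := fun j => (hinf j)⁻¹) (fun j _ => (inv_pos.2 (hpos j)).le)
      (Finset.mem_univ j))

end AdaGrad

/-! ### The empirical loss of a homogeneous model. -/

/-- A finite family of smooth functions that are homogeneous of degree `L`, with common
scale-invariant bounds. -/
structure HomogeneousModel {p N : ℕ} (q : Fin N → EuclideanSpace ℝ (Fin p) → ℝ) (L B : ℝ) :
    Prop where
  hL : 0 < L
  hB : 0 < B
  differentiable : ∀ i, Differentiable ℝ (q i)
  continuous_gradient : ∀ i, Continuous (gradient (q i))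
  homogeneous : ∀ i, ∀ α : ℝ, 0 < α → ∀ w, q i (α • w) = α ^ L * q i w
  bounds : ∀ i, HomogeneousBounds (q i) L B

lemma exists_homogeneousModel {p N : ℕ} {q : Fin N → EuclideanSpace ℝ (Fin p) → ℝ} {L : ℝ}
    (hL : 0 < L) (hq : ∀ i, Differentiable ℝ (q i))
    (hlip : ∀ i, LocallyLipschitz (gradient (q i)))
    (hhom : ∀ i, ∀ α : ℝ, 0 < α → ∀ w, q i (α • w) = α ^ L * q i w) :
    ∃ B, HomogeneousModel q L B := by
  choose B hB0 hB using fun i => exists_homogeneousBounds (hq i) (hlip i) (hhom i)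
  have hsum : 0 ≤ ∑ i, B i := Finset.sum_nonneg fun i _ => (hB0 i).le
  refine ⟨∑ i, B i + 1, hL, by linarith, hq, fun i => (hlip i).continuous, hhom,
    fun i => (hB i).mono ?_⟩
  have := Finset.single_le_sum (f := B) (fun i _ => (hB0 i).le) (Finset.mem_univ i)
  linarith

section Loss

variable {p N : ℕ} {q : Fin N → EuclideanSpace ℝ (Fin p) → ℝ} {L B : ℝ} {k : LossKind}

/-- The pull `∑ -ℓ'(q_i) q_i` of the loss on the margins. -/
noncomputable def marginPull (k : LossKind) (q : Fin N → EuclideanSpace ℝ (Fin p) → ℝ)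
    (u : EuclideanSpace ℝ (Fin p)) : ℝ :=
  ∑ i, k.slope (q i u) * q i u

lemma empiricalLoss_eq (u : EuclideanSpace ℝ (Fin p)) :
    empiricalLoss k q u = ∑ i, k.loss (q i u) := rfl

lemma hasGradientAt_empiricalLoss (hq : ∀ i, Differentiable ℝ (q i))
    (u : EuclideanSpace ℝ (Fin p)) :
    HasGradientAt (empiricalLoss k q) (-∑ i, k.slope (q i u) • gradient (q i) u) u := by
  rw [hasGradientAt_iff_hasFDerivAt]
  have h1 : HasFDerivAt (fun v => ∑ i, k.loss (q i v))
      (∑ i, (-(k.slope (q i u))) • InnerProductSpace.toDual ℝ _ (gradient (q i) u)) u :=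
    HasFDerivAt.fun_sum fun i _ =>
      (k.hasDerivAt_loss (q i u)).comp_hasFDerivAt u (hq i u).hasGradientAt.hasFDerivAt
  have h2 : InnerProductSpace.toDual ℝ _ (-∑ i, k.slope (q i u) • gradient (q i) u) =
      ∑ i, (-(k.slope (q i u))) • InnerProductSpace.toDual ℝ _ (gradient (q i) u) := by
    simp [map_sum]
  rw [h2]
  exact h1

lemma differentiable_empiricalLoss (hq : ∀ i, Differentiable ℝ (q i)) :
    Differentiable ℝ (empiricalLoss k q) :=
  fun u => (hasGradientAt_empiricalLoss hq u).differentiableAt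

lemma gradient_empiricalLoss (hq : ∀ i, Differentiable ℝ (q i)) (u : EuclideanSpace ℝ (Fin p)) :
    gradient (empiricalLoss k q) u = -∑ i, k.slope (q i u) • gradient (q i) u :=
  (hasGradientAt_empiricalLoss hq u).gradient

lemma inner_gradient_empiricalLoss_self (hq : HomogeneousModel q L B)
    (u : EuclideanSpace ℝ (Fin p)) :
    inner ℝ (gradient (empiricalLoss k q) u) u = -(L * marginPull k q u) := by
  rw [gradient_empiricalLoss hq.differentiable, inner_neg_left, sum_inner, marginPull,
    Finset.mul_sum]
  congr 1
  refine Finset.sum_congr rfl fun i _ => ?_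
  rw [real_inner_smul_left,
    inner_gradient_self_of_homogeneous (hq.differentiable i) (hq.homogeneous i)]
  ring

lemma empiricalLoss_nonneg (u : EuclideanSpace ℝ (Fin p)) : 0 ≤ empiricalLoss k q u :=
  Finset.sum_nonneg fun _ _ => (k.loss_pos _).le

lemma empiricalLoss_pos (hN : 0 < N) (u : EuclideanSpace ℝ (Fin p)) :
    0 < empiricalLoss k q u :=
  Finset.sum_pos (fun _ _ => k.loss_pos _) ⟨⟨0, hN⟩, Finset.mem_univ _⟩

/-- Every margin is at least the smoothed margin `ℓ⁻¹(ℒ)`. -/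
lemma le_margin_of_loss_eq {z : ℝ} {u : EuclideanSpace ℝ (Fin p)}
    (hz : k.loss z = empiricalLoss k q u) (i : Fin N) : z ≤ q i u := by
  refine k.loss_strictAnti.le_iff_ge.1 ?_
  rw [hz, empiricalLoss_eq]
  exact Finset.single_le_sum (f := fun i => k.loss (q i u)) (fun _ _ => (k.loss_pos _).le)
    (Finset.mem_univ i)

/-- After multiplication by `ℓ(z) = ∑ ℓ(q_i)` the inequality holds term by term, by monotonicity of
`slope / loss` and `z ≤ q_i`. -/
lemma slope_mul_le_marginPull {z : ℝ} (hz0 : 0 ≤ z) {u : EuclideanSpace ℝ (Fin p)}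
    (hz : k.loss z = empiricalLoss k q u) : k.slope z * z ≤ marginPull k q u := by
  refine le_of_mul_le_mul_right ?_ (k.loss_pos z)
  rw [marginPull, Finset.sum_mul]
  calc k.slope z * z * k.loss z = ∑ i, k.slope z * k.loss (q i u) * z := by
        rw [← Finset.sum_mul, ← Finset.mul_sum, ← empiricalLoss_eq, ← hz]
        ring
    _ ≤ ∑ i, k.slope (q i u) * q i u * k.loss z := by
        refine Finset.sum_le_sum fun i _ => ?_
        have hi := le_margin_of_loss_eq hz i
        have h1 := k.slope_mul_loss_le hi
        have h2 := k.slope_pos (q i u)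
        have h3 := k.loss_pos z
        calc k.slope z * k.loss (q i u) * z ≤ k.slope (q i u) * k.loss z * z := by gcongr
          _ ≤ k.slope (q i u) * k.loss z * q i u := by gcongr
          _ = _ := by ring

/-- The second-order error of a step is of the order of the loss. -/
lemma empiricalLoss_add_le (hq : HomogeneousModel q L B) {z : ℝ}
    {u d : EuclideanSpace ℝ (Fin p)} (hz : k.loss z = empiricalLoss k q u)
    (hz' : ∀ i, z ≤ q i (u + d)) (hu : 1 ≤ ‖u‖) (hd : ‖d‖ ≤ ‖u‖) :
    empiricalLoss k q (u + d) ≤ empiricalLoss k q u + inner ℝ (gradient (empiricalLoss k q) u) d +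
      N * ((B + 4 * B ^ 2) * (k.loss z * (‖u‖ ^ 2) ^ L) * ‖d‖ ^ 2) := by
  have hL := hq.hL
  have hB := hq.hB
  set r := ‖u‖ with hr
  have hr0 : 0 < r := by linarith
  have hu0 : u ≠ 0 := norm_pos_iff.1 hr0
  -- `B` comes from the Taylor remainder of the margin, and `4 * B ^ 2` from the square of its
  -- increment, which is at most `2 B r^(L-1) ‖d‖`. As `r ≥ 1`, both `r^(L-2)` and `r^(2L-2)` are at
  -- most `r^(2L)`.
  have hstep : ∀ i, k.loss (q i (u + d)) ≤ k.loss (q i u) -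
      k.slope (q i u) * inner ℝ (gradient (q i) u) d +
      (B + 4 * B ^ 2) * (k.loss z * (r ^ 2) ^ L) * ‖d‖ ^ 2 := by
    intro i
    set g := inner ℝ (gradient (q i) u) d with hg
    set τ := q i (u + d) - q i u - g with hτ
    have h1 : |τ| ≤ B * r ^ (L - 2) * ‖d‖ ^ 2 := (hq.bounds i).taylor u hu0 d hd
    have h2 : |g| ≤ B * r ^ (L - 1) * ‖d‖ :=
      (abs_real_inner_le_norm _ _).trans (by gcongr; exact (hq.bounds i).norm_gradient_le u hu0)
    have e1 : r ^ (L - 2) * r = r ^ (L - 1) := by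
      rw [← Real.rpow_add_one hr0.ne']; congr 1; ring
    have e2 : (r ^ 2) ^ L = r ^ (2 * L) := by
      rw [← Real.rpow_natCast r 2, ← Real.rpow_mul hr0.le]; norm_num
    have e3 : r ^ (L - 2) ≤ (r ^ 2) ^ L := by
      rw [e2]; exact Real.rpow_le_rpow_of_exponent_le hu (by linarith)
    have e4 : (r ^ (L - 1)) ^ 2 ≤ (r ^ 2) ^ L := by
      rw [e2, ← Real.rpow_natCast, ← Real.rpow_mul hr0.le]
      exact Real.rpow_le_rpow_of_exponent_le hu (by push_cast; linarith)
    have h3 : |q i (u + d) - q i u| ≤ 2 * B * r ^ (L - 1) * ‖d‖ := by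
      have h4 : q i (u + d) - q i u = τ + g := by rw [hτ]; ring
      have h5 : B * r ^ (L - 2) * ‖d‖ ^ 2 ≤ B * r ^ (L - 1) * ‖d‖ := by
        rw [← e1]
        have := Real.rpow_pos_of_pos hr0 (L - 2)
        calc B * r ^ (L - 2) * ‖d‖ ^ 2 = B * r ^ (L - 2) * ‖d‖ * ‖d‖ := by ring
          _ ≤ B * r ^ (L - 2) * ‖d‖ * r := by gcongr
          _ = _ := by ring
      rw [h4]
      have := abs_add_le τ g
      linarith
    have h6 : (q i (u + d) - q i u) ^ 2 ≤ 4 * B ^ 2 * (r ^ 2) ^ L * ‖d‖ ^ 2 := by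
      rw [← sq_abs]
      calc |q i (u + d) - q i u| ^ 2 ≤ (2 * B * r ^ (L - 1) * ‖d‖) ^ 2 := by gcongr
        _ = 4 * B ^ 2 * (r ^ (L - 1)) ^ 2 * ‖d‖ ^ 2 := by ring
        _ ≤ _ := by gcongr
    have h7 : |τ| ≤ B * (r ^ 2) ^ L * ‖d‖ ^ 2 := h1.trans (by gcongr)
    have hzi := le_margin_of_loss_eq hz i
    have h8 := k.loss_le_taylor hzi (hz' i)
    have hs := k.slope_pos (q i u)
    have hsz := k.slope_antitone hzi
    have hsl := k.slope_le_loss z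
    have h9 : -(k.slope (q i u) * τ) ≤ k.loss z * (B * (r ^ 2) ^ L * ‖d‖ ^ 2) := by
      calc -(k.slope (q i u) * τ) = k.slope (q i u) * (-τ) := by ring
        _ ≤ k.slope (q i u) * |τ| := by gcongr; exact neg_le_abs τ
        _ ≤ _ := by
            gcongr
            · exact (k.loss_pos z).le
            · exact hsz.trans hsl
    have h10 : k.slope z * (q i (u + d) - q i u) ^ 2 ≤
        k.loss z * (4 * B ^ 2 * (r ^ 2) ^ L * ‖d‖ ^ 2) := by
      gcongr
      exact (k.loss_pos z).le
    have h11 : q i (u + d) - q i u = g + τ := by rw [hτ]; ring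
    have h12 : k.slope (q i u) * (q i (u + d) - q i u) =
        k.slope (q i u) * g + k.slope (q i u) * τ := by rw [h11]; ring
    linarith
  have hsum := Finset.sum_le_sum fun i (_ : i ∈ Finset.univ) => hstep i
  rw [Finset.sum_add_distrib, Finset.sum_sub_distrib, Finset.sum_const, Finset.card_univ,
    Fintype.card_fin, nsmul_eq_mul] at hsum
  have hin : inner ℝ (gradient (empiricalLoss k q) u) d =
      -∑ i, k.slope (q i u) * inner ℝ (gradient (q i) u) d := by
    rw [gradient_empiricalLoss hq.differentiable, inner_neg_left, sum_inner]
    simp only [real_inner_smul_left]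
  rw [hin]
  simp only [empiricalLoss_eq]
  linarith

lemma norm_gradient_empiricalLoss_le (hq : HomogeneousModel q L B)
    {u : EuclideanSpace ℝ (Fin p)} (hu : u ≠ 0) :
    ‖gradient (empiricalLoss k q) u‖ ≤ B * ‖u‖ ^ (L - 1) * ∑ i, k.slope (q i u) := by
  rw [gradient_empiricalLoss hq.differentiable, norm_neg, Finset.mul_sum]
  refine (norm_sum_le _ _).trans (Finset.sum_le_sum fun i _ => ?_)
  rw [norm_smul, Real.norm_of_nonneg (k.slope_pos _).le, mul_comm]
  exact mul_le_mul_of_nonneg_right ((hq.bounds i).norm_gradient_le u hu) (k.slope_pos _).le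

lemma mul_sum_slope_le_marginPull {z : ℝ} {u : EuclideanSpace ℝ (Fin p)}
    (hz : ∀ i, z ≤ q i u) : z * ∑ i, k.slope (q i u) ≤ marginPull k q u := by
  rw [marginPull, Finset.mul_sum]
  refine Finset.sum_le_sum fun i _ => ?_
  rw [mul_comm]
  exact mul_le_mul_of_nonneg_left (hz i) (k.slope_pos _).le

end Loss

lemma norm_normalize_sub_le {F : Type*} [NormedAddCommGroup F] [NormedSpace ℝ F] {x : F}
    (hx : x ≠ 0) (y : F) : ‖‖x‖⁻¹ • x - ‖y‖⁻¹ • y‖ ≤ 2 * ‖y - x‖ / ‖x‖ := by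
  have hx0 := norm_pos_iff.2 hx
  have h1 : ‖‖y‖⁻¹ • y‖ ≤ 1 := by
    rw [norm_smul, norm_inv, norm_norm]
    exact inv_mul_le_one
  have h2 : ‖x‖ • (‖x‖⁻¹ • x - ‖y‖⁻¹ • y) = (x - y) + (‖y‖ - ‖x‖) • (‖y‖⁻¹ • y) := by
    rcases eq_or_ne y 0 with rfl | hy
    · simp [smul_smul, hx0.ne']
    · have hy0 := norm_pos_iff.2 hy
      rw [smul_sub, smul_smul, mul_inv_cancel₀ hx0.ne', one_smul, sub_smul, smul_smul ‖y‖,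
        mul_inv_cancel₀ hy0.ne', one_smul]
      abel
  have h3 := norm_add_le (x - y) ((‖y‖ - ‖x‖) • (‖y‖⁻¹ • y))
  rw [← h2, norm_smul, norm_smul, norm_norm, norm_sub_rev x y] at h3
  have h4 : ‖‖y‖ - ‖x‖‖ ≤ ‖y - x‖ := abs_norm_sub_norm_le y x
  rw [le_div_iff₀' hx0]
  have h5 : ‖‖y‖ - ‖x‖‖ * ‖‖y‖⁻¹ • y‖ ≤ ‖y - x‖ * 1 := by gcongr
  linarith

/-! ### The run of AdaGrad as an instance of the scalar margin dynamics. -/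

/-- A run of AdaGrad on a homogeneous model that from time `t₀` on separates the data, with
smoothed margin `z`, decreases the loss, and has learning rates in `[c, U]` and conditioners
bounded below by `hinf`. -/
structure SeparatedRun {p N : ℕ} (k : LossKind) (q : Fin N → EuclideanSpace ℝ (Fin p) → ℝ)
    (L B ε : ℝ) (η : ℕ → ℝ) (w : ℕ → EuclideanSpace ℝ (Fin p)) (t₀ : ℕ) (z : ℕ → ℝ)
    (hinf : EuclideanSpace ℝ (Fin p)) (c U : ℝ) : Prop where
  hN : 0 < N
  hε : 0 < ε
  hc : 0 < c
  model : HomogeneousModel q L B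
  run : IsAdaGradRun ε (empiricalLoss k q) η w
  z_pos : ∀ n, 0 < z n
  loss_z : ∀ n, k.loss (z n) = empiricalLoss k q (w (n + t₀))
  le_η : ∀ n, c ≤ η (n + t₀)
  η_le : ∀ n, η (n + t₀) ≤ U
  descent : ∀ n, empiricalLoss k q (w (n + 1 + t₀)) ≤ empiricalLoss k q (w (n + t₀)) -
    η (n + t₀) * adaGradDecrement ε (empiricalLoss k q) w (n + t₀) / 2
  summable_decrement : Summable (adaGradDecrement ε (empiricalLoss k q) w)
  hinf_pos : ∀ j, 0 < hinf j
  hinf_le : ∀ t j, hinf j ≤ adaGradConditioner ε (empiricalLoss k q) w t j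

lemma zero_of_homogeneous {F : Type*} [AddCommGroup F] [Module ℝ F] {q : F → ℝ} {L : ℝ}
    (hL : 0 < L) (hhom : ∀ α : ℝ, 0 < α → ∀ w, q (α • w) = α ^ L * q w) : q 0 = 0 := by
  have h1 := hhom 2 two_pos 0
  rw [smul_zero] at h1
  have h2 := Real.one_lt_rpow (show (1 : ℝ) < 2 by norm_num) hL
  have h3 : (2 ^ L - 1) * q 0 = 0 := by linarith
  exact (mul_eq_zero.1 h3).resolve_left (by linarith)

namespace SeparatedRun

variable {p N : ℕ} {k : LossKind} {q : Fin N → EuclideanSpace ℝ (Fin p) → ℝ}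
  {L B ε : ℝ} {η : ℕ → ℝ} {w : ℕ → EuclideanSpace ℝ (Fin p)} {t₀ : ℕ} {z : ℕ → ℝ}
  {hinf : EuclideanSpace ℝ (Fin p)} {c U : ℝ}

/-- The squared norms of the iterates. -/
noncomputable def sqNorm (k : LossKind) (q : Fin N → EuclideanSpace ℝ (Fin p) → ℝ) (ε : ℝ)
    (w : ℕ → EuclideanSpace ℝ (Fin p)) (t₀ n : ℕ) : ℝ :=
  adaGradSqNorm ε (empiricalLoss k q) w (n + t₀)

/-- The decrements of the iterates. -/
noncomputable def decrement (k : LossKind) (q : Fin N → EuclideanSpace ℝ (Fin p) → ℝ) (ε : ℝ)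
    (w : ℕ → EuclideanSpace ℝ (Fin p)) (t₀ n : ℕ) : ℝ :=
  adaGradDecrement ε (empiricalLoss k q) w (n + t₀)

/-- The pulls at the iterates. -/
noncomputable def pull (k : LossKind) (q : Fin N → EuclideanSpace ℝ (Fin p) → ℝ)
    (w : ℕ → EuclideanSpace ℝ (Fin p)) (t₀ n : ℕ) : ℝ :=
  marginPull k q (w (n + t₀))

/-- The radial growth rates of the iterates. -/
noncomputable def rate (k : LossKind) (q : Fin N → EuclideanSpace ℝ (Fin p) → ℝ) (L ε : ℝ)
    (η : ℕ → ℝ) (w : ℕ → EuclideanSpace ℝ (Fin p)) (t₀ n : ℕ) : ℝ :=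
  L * η (n + t₀) * pull k q w t₀ n / sqNorm k q ε w t₀ n

/-- The deviation of the iterates from alignment with the negative gradient. -/
noncomputable def deviation (k : LossKind) (q : Fin N → EuclideanSpace ℝ (Fin p) → ℝ) (L ε : ℝ)
    (w : ℕ → EuclideanSpace ℝ (Fin p)) (t₀ n : ℕ) : ℝ :=
  decrement k q ε w t₀ n * sqNorm k q ε w t₀ n / (L * pull k q w t₀ n) ^ 2 - 1

variable (h : SeparatedRun k q L B ε η w t₀ z hinf c U)

include h

lemma le_margin (n : ℕ) (i : Fin N) : z n ≤ q i (w (n + t₀)) :=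
  le_margin_of_loss_eq (h.loss_z n) i

lemma ne_zero (n : ℕ) : w (n + t₀) ≠ 0 := fun h0 => by
  have h1 := h.le_margin n ⟨0, h.hN⟩
  rw [h0, zero_of_homogeneous h.model.hL (h.model.homogeneous _)] at h1
  linarith [h.z_pos n]

lemma η_pos (n : ℕ) : 0 < η (n + t₀) := h.hc.trans_le (h.le_η n)

lemma U_pos : 0 < U := (h.η_pos 0).trans_le (h.η_le 0)

lemma norm_sq_le (n : ℕ) : ‖w (n + t₀)‖ ^ 2 ≤ (Real.sqrt ε)⁻¹ * sqNorm k q ε w t₀ n := by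
  rw [← div_eq_inv_mul, le_div_iff₀' (Real.sqrt_pos.2 h.hε)]
  exact sqrt_mul_norm_sq_le_adaGradSqNorm _

lemma sqNorm_pos (n : ℕ) : 0 < sqNorm k q ε w t₀ n := by
  have h1 := norm_pos_iff.2 (h.ne_zero n)
  have h2 := Real.sqrt_pos.2 h.hε
  exact lt_of_lt_of_le (by positivity) (sqrt_mul_norm_sq_le_adaGradSqNorm (n + t₀))

lemma sqNorm_le (n : ℕ) : sqNorm k q ε w t₀ n ≤ (∑ j, (hinf j)⁻¹) * ‖w (n + t₀)‖ ^ 2 :=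
  adaGradSqNorm_le h.hinf_pos h.hinf_le _

lemma sum_inv_pos : 0 < ∑ j, (hinf j)⁻¹ := by
  have h1 := norm_pos_iff.2 (h.ne_zero 0)
  by_contra! h2
  have h3 := h.sqNorm_pos 0
  have h4 := h.sqNorm_le 0
  nlinarith [sq_nonneg ‖w (0 + t₀)‖]

lemma decrement_nonneg (n : ℕ) : 0 ≤ decrement k q ε w t₀ n := adaGradDecrement_nonneg h.hε _

lemma pull_pos (n : ℕ) : 0 < pull k q w t₀ n :=
  (mul_pos (k.slope_pos _) (h.z_pos n)).trans_le
    (slope_mul_le_marginPull (h.z_pos n).le (h.loss_z n))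

lemma z_le (n : ℕ) : z n ≤ B * (Real.sqrt ε)⁻¹ ^ (L / 2) * sqNorm k q ε w t₀ n ^ (L / 2) := by
  have h1 := (le_abs_self _).trans ((h.model.bounds ⟨0, h.hN⟩).abs_le _ (h.ne_zero n))
  have h2 := h.model.hL
  have h3 := h.model.hB
  have h4 := (h.sqNorm_pos n).le
  have h5 : ‖w (n + t₀)‖ ^ L = (‖w (n + t₀)‖ ^ 2) ^ (L / 2) := by
    rw [← Real.rpow_natCast, ← Real.rpow_mul (norm_nonneg _)]
    congr 1
    push_cast
    ring
  rw [mul_assoc, ← Real.mul_rpow (by positivity) h4]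
  refine (h.le_margin n _).trans (h1.trans ?_)
  rw [h5]
  gcongr
  exact h.norm_sq_le n

lemma rate_pos (n : ℕ) : 0 < rate k q L ε η w t₀ n := by
  have h1 := h.sqNorm_pos n
  have h2 := h.pull_pos n
  have h3 := h.η_pos n
  have h4 := h.model.hL
  unfold rate
  positivity

/-- The rate and the deviation are normalized so that the first-order decrease of the loss takes the
form required by `MarginDynamics`. -/
lemma mul_rate_mul_deviation (n : ℕ) :
    L * pull k q w t₀ n * rate k q L ε η w t₀ n * (1 + deviation k q L ε w t₀ n) =
      η (n + t₀) * decrement k q ε w t₀ n := by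
  have h1 := (h.sqNorm_pos n).ne'
  have h2 := (h.pull_pos n).ne'
  have h4 := h.model.hL.ne'
  unfold rate deviation
  field_simp
  ring

lemma deviation_nonneg (n : ℕ) : 0 ≤ deviation k q L ε w t₀ n := by
  have h1 := inner_gradient_sq_le (F := empiricalLoss k q) (w := w) h.hε (n + t₀)
  rw [inner_gradient_empiricalLoss_self h.model, neg_sq] at h1
  have h2 := h.pull_pos n
  have h3 := h.model.hL
  unfold deviation
  rw [sub_nonneg, one_le_div (by positivity)]
  exact h1

lemma exists_le_sqNorm (hz : ∀ n, z 0 ≤ z n) : ∃ R₀, 0 < R₀ ∧ ∀ n, R₀ ≤ sqNorm k q ε w t₀ n := by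
  have hL := h.model.hL
  have hB := h.model.hB
  have hs := Real.sqrt_pos.2 h.hε
  have hz0 := h.z_pos 0
  set B' := B * (Real.sqrt ε)⁻¹ ^ (L / 2) with hB'
  have hB'0 : 0 < B' := by positivity
  refine ⟨(z 0 / B') ^ (2 / L), by positivity, fun n => ?_⟩
  have h1 : z 0 / B' ≤ sqNorm k q ε w t₀ n ^ (L / 2) := by
    rw [div_le_iff₀' hB'0]
    exact (hz n).trans (h.z_le n)
  refine (Real.rpow_le_rpow (by positivity) h1 (by positivity)).trans (le_of_eq ?_)
  rw [← Real.rpow_mul (h.sqNorm_pos n).le, show L / 2 * (2 / L) = 1 by field_simp, Real.rpow_one]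

lemma z_zero_le (n : ℕ) : z 0 ≤ z n := by
  refine monotone_nat_of_le_succ (fun n => ?_) (Nat.zero_le n)
  refine k.loss_strictAnti.le_iff_ge.1 ?_
  rw [h.loss_z, h.loss_z]
  have h1 := h.descent n
  have h2 := h.η_pos n
  have h3 := adaGradDecrement_nonneg (F := empiricalLoss k q) (w := w) h.hε (n + t₀)
  have h4 : 0 ≤ η (n + t₀) * adaGradDecrement ε (empiricalLoss k q) w (n + t₀) / 2 := by positivity
  linarith

lemma exists_marginDynamics : ∃ κ, MarginDynamics k L (L * c) (B * (Real.sqrt ε)⁻¹ ^ (L / 2)) z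
    (sqNorm k q ε w t₀) (rate k q L ε η w t₀) (deviation k q L ε w t₀) κ (pull k q w t₀) := by
  obtain ⟨R₀, hR₀, hR⟩ := h.exists_le_sqNorm h.z_zero_le
  have hL := h.model.hL
  have hB := h.model.hB
  have hc := h.hc
  have hs := Real.sqrt_pos.2 h.hε
  have hU := h.U_pos
  -- The two errors in `log R`: the growth of the metric, and the quadratic term `η² G / R` of the
  -- step, bounded through `η ≤ U` and `R ≥ R₀`.
  refine ⟨fun n => adaGradGrowth ε (empiricalLoss k q) w (n + t₀) +
    U ^ 2 / R₀ * decrement k q ε w t₀ n, ?_⟩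
  exact
  { hL := hL
    hc := by positivity
    hB := by positivity
    z_pos := h.z_pos
    R_pos := h.sqNorm_pos
    a_nonneg := fun n => (h.rate_pos n).le
    D_nonneg := h.deviation_nonneg
    κ_nonneg := fun n => by
      have h1 := adaGradGrowth_nonneg (F := empiricalLoss k q) (w := w) h.hε (n + t₀)
      have h2 := h.decrement_nonneg n
      positivity
    summable_κ := by
      refine Summable.add ?_ (Summable.mul_left _ ?_)
      · exact (summable_nat_add_iff t₀).2 (summable_adaGradGrowth h.hε h.hinf_pos h.hinf_le)
      · exact (summable_nat_add_iff t₀).2 h.summable_decrement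
    log_R_le := fun n => by
      have h1 := h.run.sqNorm_succ_le h.hε (n + t₀)
      rw [inner_gradient_empiricalLoss_self h.model] at h1
      have hg := adaGradGrowth_nonneg (F := empiricalLoss k q) (w := w) h.hε (n + t₀)
      have hRn := h.sqNorm_pos n
      have hG := h.decrement_nonneg n
      have ha := h.rate_pos n
      have h2 : sqNorm k q ε w t₀ (n + 1) ≤ (1 + adaGradGrowth ε (empiricalLoss k q) w (n + t₀)) *
          (sqNorm k q ε w t₀ n * (1 + (2 * rate k q L ε η w t₀ n +
            η (n + t₀) ^ 2 * decrement k q ε w t₀ n / sqNorm k q ε w t₀ n))) := by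
        unfold sqNorm at hRn ⊢
        rw [add_right_comm n 1 t₀]
        refine h1.trans (le_of_eq ?_)
        unfold rate decrement pull sqNorm
        field_simp
        ring
      have hx : 0 ≤ η (n + t₀) ^ 2 * decrement k q ε w t₀ n / sqNorm k q ε w t₀ n := by positivity
      have h3 := Real.log_le_log (h.sqNorm_pos (n + 1)) h2
      rw [Real.log_mul (by positivity) (by positivity),
        Real.log_mul (by positivity) (by positivity)] at h3
      have h4 := Real.log_le_sub_one_of_pos
        (show 0 < 1 + adaGradGrowth ε (empiricalLoss k q) w (n + t₀) by positivity)
      have h5 := Real.log_le_sub_one_of_pos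
        (show 0 < 1 + (2 * rate k q L ε η w t₀ n +
            η (n + t₀) ^ 2 * decrement k q ε w t₀ n / sqNorm k q ε w t₀ n) by positivity)
      have h6 : η (n + t₀) ^ 2 * decrement k q ε w t₀ n / sqNorm k q ε w t₀ n ≤
          U ^ 2 / R₀ * decrement k q ε w t₀ n := by
        rw [div_mul_eq_mul_div]
        have := h.η_pos n
        gcongr
        exacts [h.η_le n, hR n]
      linarith
    descent := fun n => by
      rw [h.mul_rate_mul_deviation, h.loss_z, h.loss_z]
      have := h.descent n
      unfold decrement
      linarith
    le_ν := fun n => slope_mul_le_marginPull (h.z_pos n).le (h.loss_z n)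
    z_le := h.z_le
    le_a := fun n => by
      have h1 := h.sqNorm_pos n
      have h2 := h.pull_pos n
      have h3 := h.le_η n
      unfold rate
      rw [mul_div_assoc]
      gcongr }

lemma norm_sub_sq_le (n : ℕ) : ‖w (n + 1 + t₀) - w (n + t₀)‖ ^ 2 ≤
    U * (Real.sqrt ε)⁻¹ * (η (n + t₀) * decrement k q ε w t₀ n) := by
  rw [add_right_comm n 1 t₀]
  refine (h.run.norm_sub_sq_le h.hε (n + t₀)).trans ?_
  have h1 := h.η_le n
  have h2 := h.η_pos n
  have h3 := h.decrement_nonneg n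
  have h4 := Real.sqrt_pos.2 h.hε
  calc η (n + t₀) ^ 2 * ((Real.sqrt ε)⁻¹ * decrement k q ε w t₀ n) =
      η (n + t₀) * (Real.sqrt ε)⁻¹ * (η (n + t₀) * decrement k q ε w t₀ n) := by ring
    _ ≤ _ := by gcongr

lemma tendsto_norm_sub : Tendsto (fun n => ‖w (n + 1 + t₀) - w (n + t₀)‖ ^ 2) atTop (𝓝 0) := by
  have h1 : Tendsto (decrement k q ε w t₀) atTop (𝓝 0) :=
    ((summable_nat_add_iff t₀).2 h.summable_decrement).tendsto_atTop_zero
  have h2 : Tendsto (fun n => U * (Real.sqrt ε)⁻¹ * (U * decrement k q ε w t₀ n)) atTop (𝓝 0) := by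
    simpa using (h1.const_mul U).const_mul (U * (Real.sqrt ε)⁻¹)
  refine squeeze_zero (fun n => by positivity) (fun n => ?_) h2
  refine (h.norm_sub_sq_le n).trans ?_
  have h3 := h.U_pos
  have h4 := h.decrement_nonneg n
  have h5 := h.η_le n
  have h6 := Real.sqrt_pos.2 h.hε
  gcongr

lemma tendsto_norm (hR : Tendsto (sqNorm k q ε w t₀) atTop atTop) :
    Tendsto (fun n => ‖w (n + t₀)‖) atTop atTop := by
  have h1 : Tendsto (fun n => ‖w (n + t₀)‖ ^ 2) atTop atTop := by
    refine tendsto_atTop_mono (fun n => ?_) (hR.atTop_div_const h.sum_inv_pos)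
    rw [div_le_iff₀' h.sum_inv_pos]
    exact h.sqNorm_le n
  have h2 := Real.tendsto_sqrt_atTop.comp h1
  refine h2.congr fun n => ?_
  simp [Real.sqrt_sq]

/-- The squared step length is at most a constant times `η G`, so the second-order error is at most
`C ℓ(z) R^L` times the first-order decrease `η G` itself. -/
lemma eventually_descent (hR : Tendsto (sqNorm k q ε w t₀) atTop atTop) : ∃ C, 0 ≤ C ∧
    ∀ᶠ n in atTop, (1 - C * (k.loss (z n) * sqNorm k q ε w t₀ n ^ L)) *
      (L * pull k q w t₀ n * rate k q L ε η w t₀ n * (1 + deviation k q L ε w t₀ n)) ≤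
        k.loss (z n) - k.loss (z (n + 1)) := by
  have hB := h.model.hB
  have hs := Real.sqrt_pos.2 h.hε
  have hU := h.U_pos
  have hL := h.model.hL
  obtain ⟨κ, hdyn⟩ := h.exists_marginDynamics
  refine ⟨N * ((B + 4 * B ^ 2) * ((Real.sqrt ε)⁻¹ ^ L) * (U * (Real.sqrt ε)⁻¹)), by positivity, ?_⟩
  filter_upwards [(h.tendsto_norm hR).eventually_ge_atTop 1,
    h.tendsto_norm_sub.eventually_le_const one_pos] with n hn hd
  rw [h.mul_rate_mul_deviation, h.loss_z (n + 1)]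
  set d := w (n + 1 + t₀) - w (n + t₀) with hd'
  have hwd : w (n + 1 + t₀) = w (n + t₀) + d := by rw [hd', add_sub_cancel]
  have hd1 : ‖d‖ ≤ 1 := by
    by_contra! h1
    nlinarith
  have hz' : ∀ i, z n ≤ q i (w (n + t₀) + d) := fun i => by
    rw [← hwd]
    exact (hdyn.z_le_succ n).trans (h.le_margin (n + 1) i)
  have h1 := empiricalLoss_add_le h.model (h.loss_z n) hz' hn (hd1.trans hn)
  rw [← hwd] at h1
  have h2 : inner ℝ (gradient (empiricalLoss k q) (w (n + t₀))) d =
      -(η (n + t₀) * decrement k q ε w t₀ n) := by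
    rw [hd', add_right_comm n 1 t₀, h.run (n + t₀), inner_neg_right, real_inner_smul_right,
      inner_hadamardVec_gradient]
    rfl
  rw [h2, ← h.loss_z n] at h1
  have h3 := h.norm_sub_sq_le n
  rw [← hd'] at h3
  have hRn := h.sqNorm_pos n
  have h4 : (‖w (n + t₀)‖ ^ 2) ^ L ≤ (Real.sqrt ε)⁻¹ ^ L * sqNorm k q ε w t₀ n ^ L := by
    rw [← Real.mul_rpow (by positivity) hRn.le]
    have := h.norm_sq_le n
    gcongr
  have h5 : (N : ℝ) * ((B + 4 * B ^ 2) * (k.loss (z n) * (‖w (n + t₀)‖ ^ 2) ^ L) * ‖d‖ ^ 2) ≤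
      N * ((B + 4 * B ^ 2) * (k.loss (z n) * ((Real.sqrt ε)⁻¹ ^ L * sqNorm k q ε w t₀ n ^ L)) *
        (U * (Real.sqrt ε)⁻¹ * (η (n + t₀) * decrement k q ε w t₀ n))) := by
    have := (k.loss_pos (z n)).le
    gcongr
  linarith

/-- Once margins are at least `γ' r^L` for `r = ‖w‖`, the gradient is at most `B r^(L-1) ∑ slope ≤ B
ν / (γ' r)`. The relative step length is then of order `η ν / r²`, hence of order `a`. -/
lemma eventually_dist_le {γ : ℝ} (hγ : 0 < γ)
    (hz : ∀ᶠ n in atTop, γ * sqNorm k q ε w t₀ n ^ (L / 2) ≤ z n) :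
    ∃ γ', 0 < γ' ∧ ∃ C, ∀ᶠ n in atTop, γ' * ‖w (n + t₀)‖ ^ L ≤ z n ∧
      dist (‖w (n + t₀)‖⁻¹ • w (n + t₀)) (‖w (n + 1 + t₀)‖⁻¹ • w (n + 1 + t₀)) ≤
        C * rate k q L ε η w t₀ n := by
  have hB := h.model.hB
  have hs := Real.sqrt_pos.2 h.hε
  have hL := h.model.hL
  have hH := h.sum_inv_pos
  set γ' := γ * Real.sqrt ε ^ (L / 2) with hγ'
  have hγ'0 : 0 < γ' := by positivity
  refine ⟨γ', hγ'0, 2 * (Real.sqrt ε)⁻¹ * B * (∑ j, (hinf j)⁻¹) / (γ' * L), ?_⟩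
  filter_upwards [hz] with n hn
  have hw := h.ne_zero n
  set r := ‖w (n + t₀)‖ with hr
  have hr0 : 0 < r := norm_pos_iff.2 hw
  have hRn := h.sqNorm_pos n
  have h1 : γ' * r ^ L ≤ z n := by
    refine le_trans ?_ hn
    have h2 : r ^ L = (r ^ 2) ^ (L / 2) := by
      rw [← Real.rpow_natCast, ← Real.rpow_mul hr0.le]
      congr 1
      push_cast
      ring
    rw [hγ', mul_assoc, h2, ← Real.mul_rpow hs.le (by positivity)]
    have h3 : Real.sqrt ε * r ^ 2 ≤ sqNorm k q ε w t₀ n := sqrt_mul_norm_sq_le_adaGradSqNorm _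
    gcongr
  refine ⟨h1, ?_⟩
  rw [dist_eq_norm]
  refine (norm_normalize_sub_le hw _).trans ?_
  set g := ‖gradient (empiricalLoss k q) (w (n + t₀))‖ with hg
  have hη := h.η_pos n
  have h2 : ‖w (n + 1 + t₀) - w (n + t₀)‖ ≤ η (n + t₀) * ((Real.sqrt ε)⁻¹ * g) := by
    rw [add_right_comm n 1 t₀, h.run (n + t₀), norm_neg, norm_smul, Real.norm_of_nonneg hη.le]
    gcongr
    refine (sq_le_sq₀ (norm_nonneg _) (by positivity)).1 ?_
    rw [hg, mul_pow, EuclideanSpace.real_norm_sq_eq, EuclideanSpace.real_norm_sq_eq,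
      Finset.mul_sum]
    refine Finset.sum_le_sum fun j _ => ?_
    rw [hadamardVec_apply, mul_pow]
    have h3 := adaGradConditioner_le (F := empiricalLoss k q) (w := w) h.hε (n + t₀) j
    have h4 := adaGradConditioner_pos (F := empiricalLoss k q) (w := w) h.hε (n + t₀) j
    gcongr
  have h3 : g ≤ B * pull k q w t₀ n / (γ' * r) := by
    have h4 := norm_gradient_empiricalLoss_le (k := k) h.model hw
    have h5 := mul_sum_slope_le_marginPull (k := k) (fun i => h1.trans (h.le_margin n i))
    rw [le_div_iff₀ (by positivity)]
    rw [Real.rpow_sub_one hr0.ne'] at h4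
    calc g * (γ' * r) ≤ (B * (r ^ L / r) * ∑ i, k.slope (q i (w (n + t₀)))) * (γ' * r) := by gcongr
      _ = B * (γ' * r ^ L * ∑ i, k.slope (q i (w (n + t₀)))) := by field_simp
      _ ≤ _ := by
          gcongr
          exact h5
  have hν := h.pull_pos n
  have halg : ∀ H : ℝ, 0 < H →
      2 * (η (n + t₀) * ((Real.sqrt ε)⁻¹ * (B * pull k q w t₀ n / (γ' * r)))) / r =
        2 * (Real.sqrt ε)⁻¹ * B * H / (γ' * L) *
          (L * η (n + t₀) * pull k q w t₀ n / (H * r ^ 2)) := by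
    intro H hH
    field_simp
  have h6 : rate k q L ε η w t₀ n ≥
      L * η (n + t₀) * pull k q w t₀ n / ((∑ j, (hinf j)⁻¹) * r ^ 2) := by
    unfold rate
    have := h.sqNorm_le n
    gcongr
  calc 2 * ‖w (n + 1 + t₀) - w (n + t₀)‖ / r
      ≤ 2 * (η (n + t₀) * ((Real.sqrt ε)⁻¹ * (B * pull k q w t₀ n / (γ' * r)))) / r := by
        gcongr
        exact h2.trans (by gcongr)
    _ = 2 * (Real.sqrt ε)⁻¹ * B * (∑ j, (hinf j)⁻¹) / (γ' * L) *
        (L * η (n + t₀) * pull k q w t₀ n / ((∑ j, (hinf j)⁻¹) * r ^ 2)) :=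
        halg _ hH
    _ ≤ _ := by gcongr

/-- Every limit direction of the iterates is approached along times at which the iterates become
aligned with the negative gradient, with margins of the order of `‖w‖ ^ L`. -/
theorem exists_aligned_subseq {wbar : EuclideanSpace ℝ (Fin p)}
    (hw : MapClusterPt wbar atTop fun t => ‖w t‖⁻¹ • w t) :
    ∃ γ, 0 < γ ∧ ∃ ψ : ℕ → ℕ, Tendsto ψ atTop atTop ∧
      Tendsto (fun n => ‖w (ψ n + t₀)‖) atTop atTop ∧
      Tendsto (fun n => ‖w (ψ n + t₀)‖⁻¹ • w (ψ n + t₀)) atTop (𝓝 wbar) ∧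
      Tendsto (fun n => deviation k q L ε w t₀ (ψ n)) atTop (𝓝 0) ∧
      ∀ᶠ n in atTop, γ * ‖w (ψ n + t₀)‖ ^ L ≤ z (ψ n) := by
  obtain ⟨κ, hdyn⟩ := h.exists_marginDynamics
  obtain ⟨C, hC, hdesc⟩ := h.eventually_descent hdyn.tendsto_R
  obtain ⟨hsum, γ, hγ, hz⟩ := hdyn.alignment hC hdesc
  obtain ⟨γ', hγ', C', hev⟩ := h.eventually_dist_le hγ hz
  have hw' : MapClusterPt wbar atTop fun n => ‖w (n + t₀)‖⁻¹ • w (n + t₀) := by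
    have h1 : map (fun n => ‖w (n + t₀)‖⁻¹ • w (n + t₀)) atTop =
        map (fun t => ‖w t‖⁻¹ • w t) atTop := by
      rw [show (fun n => ‖w (n + t₀)‖⁻¹ • w (n + t₀)) =
        (fun t => ‖w t‖⁻¹ • w t) ∘ fun n => n + t₀ from rfl, ← Filter.map_map,
        map_add_atTop_eq_nat]
    unfold MapClusterPt at hw ⊢
    rw [h1]
    exact hw
  obtain ⟨ψ, hψ, hlim⟩ := (hw'.prodMk_zero_of_summable (fun n => (h.rate_pos n).le)
    h.deviation_nonneg hdyn.not_summable_a hsum (hev.mono fun n hn => hn.2)).tendsto_subseq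
  have hψ' := hψ.tendsto_atTop
  exact ⟨γ', hγ', ψ, hψ', (h.tendsto_norm hdyn.tendsto_R).comp hψ',
    (continuous_fst.tendsto _).comp hlim, (continuous_snd.tendsto _).comp hlim,
    hψ'.eventually (hev.mono fun n hn => hn.1)⟩

end SeparatedRun

/-! ### From a stationary direction to a KKT point. -/

section KKT

variable {p N : ℕ} {q : Fin N → EuclideanSpace ℝ (Fin p) → ℝ} {L B : ℝ}
  {hinf : EuclideanSpace ℝ (Fin p)}

lemma norm_hadamardVec_powVec (hpos : ∀ j, 0 < hinf j) (u : EuclideanSpace ℝ (Fin p)) :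
    ‖hadamardVec (powVec hinf (-(1 / 2))) u‖ = Real.sqrt (∑ j, (hinf j)⁻¹ * u j ^ 2) := by
  rw [← Real.sqrt_sq (norm_nonneg _), EuclideanSpace.real_norm_sq_eq]
  congr 1
  refine Finset.sum_congr rfl fun j _ => ?_
  rw [hadamardVec_apply, powVec_apply, mul_pow, ← Real.rpow_natCast (hinf j ^ _),
    ← Real.rpow_mul (hpos j).le]
  norm_num
  exact Or.inl (Real.rpow_neg_one _)

lemma sum_inv_mul_sq_pos (hpos : ∀ j, 0 < hinf j) {v : EuclideanSpace ℝ (Fin p)} (hv : v ≠ 0) :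
    0 < ∑ j, (hinf j)⁻¹ * v j ^ 2 := by
  obtain ⟨j, hj⟩ : ∃ j, v j ≠ 0 := by
    by_contra! h0
    exact hv (by ext j; exact h0 j)
  exact Finset.sum_pos' (fun j _ => mul_nonneg (inv_pos.2 (hpos j)).le (sq_nonneg _))
    ⟨j, Finset.mem_univ j, mul_pos (inv_pos.2 (hpos j)) (by positivity)⟩

/-- The objective is the norm and not its square: the origin is excluded, and the norm appears in
the denominator of the gradient. -/
lemma hasGradientAt_weightedNorm (hpos : ∀ j, 0 < hinf j) {v : EuclideanSpace ℝ (Fin p)}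
    (hv : v ≠ 0) :
    HasGradientAt (fun u => 1 / 2 * ‖hadamardVec (powVec hinf (-(1 / 2))) u‖)
      ((2 * Real.sqrt (∑ j, (hinf j)⁻¹ * v j ^ 2))⁻¹ •
        WithLp.toLp 2 fun j => (hinf j)⁻¹ * v j) v := by
  have hQ := sum_inv_mul_sq_pos hpos hv
  simp only [norm_hadamardVec_powVec hpos]
  rw [hasGradientAt_iff_hasFDerivAt]
  have h1 : ∀ j, HasFDerivAt (fun u : EuclideanSpace ℝ (Fin p) => (hinf j)⁻¹ * u j ^ 2)
      ((hinf j)⁻¹ • ((2 * v j ^ 1) • (EuclideanSpace.proj j : EuclideanSpace ℝ (Fin p) →L[ℝ] ℝ))) v :=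
    fun j => by
      have h2 := ((EuclideanSpace.proj j :
        EuclideanSpace ℝ (Fin p) →L[ℝ] ℝ).hasFDerivAt (x := v)).pow 2
      refine (h2.const_mul _).congr_fderiv ?_
      ext u
      simp
  have h2 := ((HasFDerivAt.fun_sum (u := Finset.univ) fun j _ => h1 j).sqrt hQ.ne').const_mul
    (1 / 2)
  refine h2.congr_fderiv ?_
  ext u
  have hs := (Real.sqrt_pos.2 hQ).ne'
  rw [InnerProductSpace.toDual_apply_apply, real_inner_smul_left]
  simp only [PiLp.inner_apply, RCLike.inner_apply, conj_trivial, _root_.smul_apply,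
    _root_.sum_apply, smul_eq_mul, Finset.mul_sum, PiLp.proj_apply, pow_one]
  refine Finset.sum_congr rfl fun j _ => ?_
  field_simp

/-- A stationary direction with positive margins, whose multipliers are supported on the smallest
margins, is along the direction of a KKT point of the margin maximization problem. -/
lemma exists_isKKTPoint (hq : HomogeneousModel q L B) (hN : 0 < N) (hpos : ∀ j, 0 < hinf j)
    {v : EuclideanSpace ℝ (Fin p)} (hv : ∀ i, 0 < q i v) {lam : Fin N → ℝ} (hlam : ∀ i, 0 ≤ lam i)
    (hstat : ∀ j, v j = hinf j * ∑ i, lam i * gradient (q i) v j)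
    (hslack : ∀ i i', q i' v < q i v → lam i = 0) :
    ∃ c : ℝ, 0 < c ∧ IsKKTPoint (fun u => 1 / 2 * ‖hadamardVec (powVec hinf (-(1 / 2))) u‖)
      (fun i u => 1 - q i u) (c • v) := by
  have : Nonempty (Fin N) := ⟨⟨0, hN⟩⟩
  obtain ⟨i₀, hi₀⟩ := Finite.exists_min fun i => q i v
  have hm := hv i₀
  have hL := hq.hL
  have hv0 : v ≠ 0 := fun h0 => by
    rw [h0, zero_of_homogeneous hq.hL (hq.homogeneous _)] at hm
    exact lt_irrefl _ hm
  -- This scaling makes the smallest margin equal to `1`.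
  set c := (q i₀ v) ^ (-L⁻¹) with hc
  have hc0 : 0 < c := Real.rpow_pos_of_pos hm _
  have hcL : c ^ L = (q i₀ v)⁻¹ := by
    rw [hc, ← Real.rpow_mul hm.le, neg_mul, inv_mul_cancel₀ hL.ne', Real.rpow_neg_one]
  have hqc : ∀ i, q i (c • v) = q i v / q i₀ v := fun i => by
    rw [hq.homogeneous i c hc0, hcL, inv_mul_eq_div]
  have hcv : c • v ≠ 0 := smul_ne_zero hc0.ne' hv0
  have hobj := hasGradientAt_weightedNorm hpos hcv
  have hcon : ∀ i, HasGradientAt (fun u => 1 - q i u) (-gradient (q i) (c • v)) (c • v) := by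
    intro i
    rw [hasGradientAt_iff_hasFDerivAt, map_neg]
    exact (hq.differentiable i (c • v)).hasGradientAt.hasFDerivAt.const_sub 1
  refine ⟨c, hc0, ⟨fun i => ?_, hobj.differentiableAt, fun i => (hcon i).differentiableAt, ?_⟩⟩
  · rw [hqc, sub_nonpos, one_le_div hm]
    exact hi₀ i
  · have hQ := Real.sqrt_pos.2 (sum_inv_mul_sq_pos hpos hcv)
    set θ := (2 * Real.sqrt (∑ j, (hinf j)⁻¹ * (c • v) j ^ 2))⁻¹ with hθ
    have hθ0 : 0 < θ := by positivity
    have hcL1 : 0 < c ^ (L - 1) := Real.rpow_pos_of_pos hc0 _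
    -- At `c • v` the gradient of the objective is `θ c` times `h⁻¹ ⊙ v`, whereas those of the
    -- margins are multiplied by `c ^ (L - 1)`.
    refine ⟨fun i => θ * c / c ^ (L - 1) * lam i, fun i => mul_nonneg (by positivity) (hlam i),
      ?_, fun i => ?_⟩
    · rw [hobj.gradient]
      simp only [(hcon _).gradient]
      ext j
      have hstat' : (hinf j)⁻¹ * v j = ∑ i, lam i * gradient (q i) v j := by
        rw [hstat j, inv_mul_cancel_left₀ (hpos j).ne']
      simp only [gradient_smul_of_homogeneous (hq.differentiable _) (hq.homogeneous _) hc0,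
        PiLp.add_apply, PiLp.smul_apply, smul_eq_mul, WithLp.ofLp_sum, Finset.sum_apply,
        PiLp.neg_apply, PiLp.zero_apply]
      have h1 : ∑ i, θ * c / c ^ (L - 1) * lam i * -(c ^ (L - 1) * gradient (q i) v j) =
          -(θ * c * ∑ i, lam i * gradient (q i) v j) := by
        rw [Finset.mul_sum, ← Finset.sum_neg_distrib]
        refine Finset.sum_congr rfl fun i _ => ?_
        field_simp
      rw [h1, ← hstat']
      ring
    · change θ * c / c ^ (L - 1) * lam i * (1 - q i (c • v)) = 0
      rw [hqc]
      rcases (hi₀ i).eq_or_lt with heq | hlt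
      · rw [← heq, div_self hm.ne', sub_self, mul_zero]
      · rw [hslack i i₀ hlt, mul_zero, zero_mul]

end KKT

/-! ### Multipliers of the iterates and their limits. -/

namespace SeparatedRun

variable {p N : ℕ} {k : LossKind} {q : Fin N → EuclideanSpace ℝ (Fin p) → ℝ}
  {L B ε : ℝ} {η : ℕ → ℝ} {w : ℕ → EuclideanSpace ℝ (Fin p)} {t₀ : ℕ} {z : ℕ → ℝ}
  {hinf : EuclideanSpace ℝ (Fin p)} {c U : ℝ}

/-- The approximate multipliers of the normalized iterates. -/
noncomputable def multiplier (k : LossKind) (q : Fin N → EuclideanSpace ℝ (Fin p) → ℝ) (L ε : ℝ)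
    (w : ℕ → EuclideanSpace ℝ (Fin p)) (t₀ n : ℕ) (i : Fin N) : ℝ :=
  sqNorm k q ε w t₀ n / (L * pull k q w t₀ n) * ‖w (n + t₀)‖ ^ (L - 2) *
    k.slope (q i (w (n + t₀)))

variable (h : SeparatedRun k q L B ε η w t₀ z hinf c U)

include h

lemma multiplier_nonneg (n : ℕ) (i : Fin N) : 0 ≤ multiplier k q L ε w t₀ n i := by
  have h1 := h.sqNorm_pos n
  have h2 := h.pull_pos n
  have h3 := h.model.hL
  have h4 := k.slope_pos (q i (w (n + t₀)))
  unfold multiplier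
  positivity

/-- The pull is bounded below by its term `i'` alone. The choice `i' = i` gives boundedness; an `i'`
of smaller limiting margin gives complementary slackness. -/
lemma multiplier_le {γ : ℝ} (hγ : 0 < γ) {n : ℕ} (hn : γ * ‖w (n + t₀)‖ ^ L ≤ z n)
    (i i' : Fin N) : multiplier k q L ε w t₀ n i ≤ (∑ j, (hinf j)⁻¹) / (L * γ) *
      (k.slope (q i (w (n + t₀))) / k.slope (q i' (w (n + t₀)))) := by
  have hR := h.sqNorm_le n
  have hν := h.pull_pos n
  have hL := h.model.hL
  have hH := h.sum_inv_pos
  have hs := k.slope_pos (q i (w (n + t₀)))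
  have hs' := k.slope_pos (q i' (w (n + t₀)))
  have hr := norm_pos_iff.2 (h.ne_zero n)
  have hν' : γ * ‖w (n + t₀)‖ ^ L * k.slope (q i' (w (n + t₀))) ≤ pull k q w t₀ n := by
    have h1 : k.slope (q i' (w (n + t₀))) * q i' (w (n + t₀)) ≤ pull k q w t₀ n :=
      Finset.single_le_sum (f := fun i => k.slope (q i (w (n + t₀))) * q i (w (n + t₀)))
        (fun i _ => mul_nonneg (k.slope_pos _).le ((h.z_pos n).le.trans (h.le_margin n i)))
        (Finset.mem_univ i')
    refine le_trans ?_ h1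
    rw [mul_comm]
    exact mul_le_mul_of_nonneg_left (hn.trans (h.le_margin n i')) hs'.le
  have hrL : ‖w (n + t₀)‖ ^ 2 * ‖w (n + t₀)‖ ^ (L - 2) = ‖w (n + t₀)‖ ^ L := by
    rw [← Real.rpow_natCast, ← Real.rpow_add hr]
    congr 1
    push_cast
    ring
  have hrL0 := Real.rpow_pos_of_pos hr L
  calc multiplier k q L ε w t₀ n i
      ≤ (∑ j, (hinf j)⁻¹) * ‖w (n + t₀)‖ ^ 2 /
        (L * (γ * ‖w (n + t₀)‖ ^ L * k.slope (q i' (w (n + t₀))))) * ‖w (n + t₀)‖ ^ (L - 2) *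
        k.slope (q i (w (n + t₀))) := by
        unfold multiplier
        gcongr
    _ = (∑ j, (hinf j)⁻¹) * (‖w (n + t₀)‖ ^ 2 * ‖w (n + t₀)‖ ^ (L - 2)) /
        (L * (γ * ‖w (n + t₀)‖ ^ L * k.slope (q i' (w (n + t₀))))) *
        k.slope (q i (w (n + t₀))) := by ring
    _ = _ := by
        rw [hrL]
        generalize ∑ j, (hinf j)⁻¹ = H
        field_simp

/-- In the metric `h⁻¹`, the squared norm of `w + s h ⊙ ∇ℒ` is `R - 2 s L ν + s² G`. For `s = R / (L
ν)` it equals `R D`; it dominates each coordinate, and division by `‖w‖²` removes the scale. -/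
lemma stationarity_error_le (n : ℕ) (j : Fin p) :
    ((‖w (n + t₀)‖⁻¹ • w (n + t₀)) j - adaGradConditioner ε (empiricalLoss k q) w (n + t₀) j *
      ∑ i, multiplier k q L ε w t₀ n i * gradient (q i) (‖w (n + t₀)‖⁻¹ • w (n + t₀)) j) ^ 2 ≤
      (Real.sqrt ε)⁻¹ * (∑ j, (hinf j)⁻¹) * deviation k q L ε w t₀ n := by
  have hL := h.model.hL
  have hν := h.pull_pos n
  have hRn := h.sqNorm_pos n
  have hr := norm_pos_iff.2 (h.ne_zero n)
  have hD := h.deviation_nonneg n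
  set r := ‖w (n + t₀)‖ with hrdef
  set F := empiricalLoss k q with hF
  set s := sqNorm k q ε w t₀ n / (L * pull k q w t₀ n) with hs
  set g := gradient F (w (n + t₀)) with hg
  have hgj : g j = -∑ i, k.slope (q i (w (n + t₀))) * gradient (q i) (w (n + t₀)) j := by
    rw [hg, hF, gradient_empiricalLoss h.model.differentiable]
    simp [WithLp.ofLp_sum, Finset.sum_apply]
  have h1 : ∑ i, multiplier k q L ε w t₀ n i * gradient (q i) (r⁻¹ • w (n + t₀)) j =
      -(s / r * g j) := by
    rw [hgj, mul_neg, neg_neg, Finset.mul_sum]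
    refine Finset.sum_congr rfl fun i _ => ?_
    rw [gradient_smul_of_homogeneous (h.model.differentiable i) (h.model.homogeneous i)
      (inv_pos.2 hr)]
    unfold multiplier
    rw [← hrdef, ← hs, PiLp.smul_apply, smul_eq_mul]
    have h2 : r ^ (L - 2) * r⁻¹ ^ (L - 1) = r⁻¹ := by
      rw [Real.inv_rpow hr.le, ← Real.rpow_neg hr.le, ← Real.rpow_add hr, ← Real.rpow_neg_one]
      congr 1
      ring
    calc _ = s * (r ^ (L - 2) * r⁻¹ ^ (L - 1)) * (k.slope (q i (w (n + t₀))) *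
          gradient (q i) (w (n + t₀)) j) := by ring
      _ = _ := by rw [h2, div_eq_mul_inv]
  have hterm : ∀ j, (adaGradConditioner ε F w (n + t₀) j)⁻¹ * (w (n + t₀) j +
      s * (adaGradConditioner ε F w (n + t₀) j * g j)) ^ 2 =
      (adaGradConditioner ε F w (n + t₀) j)⁻¹ * w (n + t₀) j ^ 2 + 2 * s * (w (n + t₀) j * g j) +
        s ^ 2 * (adaGradConditioner ε F w (n + t₀) j * g j ^ 2) := fun j => by
    have := (adaGradConditioner_pos (F := F) (w := w) h.hε (n + t₀) j).ne'
    field_simp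
    ring
  have hinner : ∑ j, w (n + t₀) j * g j = -(L * pull k q w t₀ n) := by
    have := inner_gradient_empiricalLoss_self (k := k) h.model (w (n + t₀))
    simp only [PiLp.inner_apply, RCLike.inner_apply, conj_trivial] at this
    exact this
  have hsum : ∑ j, (adaGradConditioner ε F w (n + t₀) j)⁻¹ * (w (n + t₀) j +
      s * (adaGradConditioner ε F w (n + t₀) j * g j)) ^ 2 =
      sqNorm k q ε w t₀ n * deviation k q L ε w t₀ n := by
    simp only [hterm]
    rw [Finset.sum_add_distrib, Finset.sum_add_distrib, ← Finset.mul_sum, ← Finset.mul_sum, hinner]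
    change sqNorm k q ε w t₀ n + _ + s ^ 2 * decrement k q ε w t₀ n = _
    unfold deviation
    rw [hs]
    field_simp
    ring
  have hpos := adaGradConditioner_pos (F := F) (w := w) h.hε (n + t₀) j
  have h2 := Finset.single_le_sum (f := fun j => (adaGradConditioner ε F w (n + t₀) j)⁻¹ *
    (w (n + t₀) j + s * (adaGradConditioner ε F w (n + t₀) j * g j)) ^ 2)
    (fun j _ => mul_nonneg (inv_pos.2 (adaGradConditioner_pos h.hε _ j)).le (sq_nonneg _))
    (Finset.mem_univ j)
  rw [hsum] at h2
  simp only at h2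
  rw [inv_mul_le_iff₀ hpos] at h2
  have h3 := adaGradConditioner_le (F := F) (w := w) h.hε (n + t₀) j
  have h4 := h.sqNorm_le n
  rw [h1, PiLp.smul_apply, smul_eq_mul]
  have h5 : r⁻¹ * w (n + t₀) j - adaGradConditioner ε F w (n + t₀) j * -(s / r * g j) =
      (w (n + t₀) j + s * (adaGradConditioner ε F w (n + t₀) j * g j)) / r := by
    field_simp
    ring
  rw [h5, div_pow, div_le_iff₀ (by positivity)]
  have h6 : 0 ≤ sqNorm k q ε w t₀ n * deviation k q L ε w t₀ n := by positivity
  have h7 : 0 < (Real.sqrt ε)⁻¹ := inv_pos.2 (Real.sqrt_pos.2 h.hε)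
  calc _ ≤ _ := h2
    _ ≤ (Real.sqrt ε)⁻¹ * ((∑ j, (hinf j)⁻¹) * r ^ 2 * deviation k q L ε w t₀ n) := by gcongr
    _ = _ := by ring

/-- Every limit direction of the iterates is along the direction of a KKT point. -/
theorem exists_isKKTPoint_of_mapClusterPt
    (hlim : Tendsto (adaGradConditioner ε (empiricalLoss k q) w) atTop (𝓝 hinf))
    {wbar : EuclideanSpace ℝ (Fin p)} (hw : MapClusterPt wbar atTop fun t => ‖w t‖⁻¹ • w t) :
    ∃ c : ℝ, 0 < c ∧ IsKKTPoint (fun u => 1 / 2 * ‖hadamardVec (powVec hinf (-(1 / 2))) u‖)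
      (fun i u => 1 - q i u) (c • wbar) := by
  obtain ⟨γ, hγ, ψ, hψ, hnorm, hdir, hdev, hz⟩ := h.exists_aligned_subseq hw
  have hL := h.model.hL
  have hmargin : ∀ n i, q i (‖w (ψ n + t₀)‖⁻¹ • w (ψ n + t₀)) =
      (‖w (ψ n + t₀)‖ ^ L)⁻¹ * q i (w (ψ n + t₀)) := fun n i => by
    have hr := norm_pos_iff.2 (h.ne_zero (ψ n))
    rw [h.model.homogeneous i _ (inv_pos.2 hr), Real.inv_rpow hr.le]
  have hqlim : ∀ i, Tendsto (fun n => q i (‖w (ψ n + t₀)‖⁻¹ • w (ψ n + t₀))) atTop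
      (𝓝 (q i wbar)) := fun i =>
    ((h.model.differentiable i).continuous.tendsto wbar).comp hdir
  have hqpos : ∀ i, 0 < q i wbar := fun i => by
    refine hγ.trans_le (ge_of_tendsto (hqlim i) ?_)
    filter_upwards [hz] with n hn
    have hr := Real.rpow_pos_of_pos (norm_pos_iff.2 (h.ne_zero (ψ n))) L
    rw [hmargin, ← div_eq_inv_mul, le_div_iff₀ hr]
    exact hn.trans (h.le_margin _ i)
  have hmul : ∀ᶠ n in atTop, multiplier k q L ε w t₀ (ψ n) ∈
      Set.Icc (0 : Fin N → ℝ) fun _ => (∑ j, (hinf j)⁻¹) / (L * γ) := by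
    filter_upwards [hz] with n hn
    refine ⟨fun i => h.multiplier_nonneg _ i, fun i => ?_⟩
    have := h.multiplier_le hγ hn i i
    rwa [div_self (k.slope_pos _).ne', mul_one] at this
  obtain ⟨lam, hlam, φ, hφ, hlamlim⟩ :=
    isCompact_Icc.tendsto_subseq' hmul.frequently
  have hφ' := hφ.tendsto_atTop
  have hlami := tendsto_pi_nhds.1 hlamlim
  refine exists_isKKTPoint h.model h.hN h.hinf_pos hqpos (lam := lam) (fun i => hlam.1 i)
    (fun j => ?_) (fun i i' hlt => ?_)
  · have hcoord : ∀ j, Continuous fun u : EuclideanSpace ℝ (Fin p) => u j := fun j =>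
      (EuclideanSpace.proj (𝕜 := ℝ) j).continuous
    have h1 : Tendsto (fun n => ((‖w (ψ (φ n) + t₀)‖⁻¹ • w (ψ (φ n) + t₀)) j -
        adaGradConditioner ε (empiricalLoss k q) w (ψ (φ n) + t₀) j *
        ∑ i, multiplier k q L ε w t₀ (ψ (φ n)) i *
          gradient (q i) (‖w (ψ (φ n) + t₀)‖⁻¹ • w (ψ (φ n) + t₀)) j) ^ 2) atTop
        (𝓝 ((wbar j - hinf j * ∑ i, lam i * gradient (q i) wbar j) ^ 2)) := by
      refine Tendsto.pow (Tendsto.sub ?_ (Tendsto.mul ?_ (tendsto_finsetSum _ fun i _ =>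
        Tendsto.mul (hlami i) ?_))) 2
      · exact ((hcoord j).tendsto wbar).comp (hdir.comp hφ')
      · exact ((hcoord j).tendsto hinf).comp
          (hlim.comp ((tendsto_add_atTop_nat t₀).comp (hψ.comp hφ')))
      · exact (((hcoord j).comp (h.model.continuous_gradient i)).tendsto wbar).comp
          (hdir.comp hφ')
    have h2 : Tendsto (fun n => (Real.sqrt ε)⁻¹ * (∑ j, (hinf j)⁻¹) *
        deviation k q L ε w t₀ (ψ (φ n))) atTop (𝓝 0) := by
      simpa using (hdev.comp hφ').const_mul ((Real.sqrt ε)⁻¹ * (∑ j, (hinf j)⁻¹))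
    have h3 := le_of_tendsto_of_tendsto' h1 h2 fun n => h.stationarity_error_le (ψ (φ n)) j
    have h4 := pow_eq_zero_iff two_ne_zero |>.1 (le_antisymm h3 (sq_nonneg _))
    linarith
  -- If `q i' < q i` in the limit direction, the actual margins differ by a gap growing like
  -- `‖w‖^L`, so the quotient of the slopes tends to zero exponentially.
  · have hr : Tendsto (fun n => ‖w (ψ n + t₀)‖ ^ L) atTop atTop :=
      (tendsto_rpow_atTop hL).comp hnorm
    have hdiff := (hqlim i).sub (hqlim i')
    have hgap : Tendsto (fun n => ‖w (ψ n + t₀)‖ ^ L *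
        (q i (‖w (ψ n + t₀)‖⁻¹ • w (ψ n + t₀)) - q i' (‖w (ψ n + t₀)‖⁻¹ • w (ψ n + t₀))))
        atTop atTop := hr.atTop_mul_pos (sub_pos.2 hlt) hdiff
    have hzero : Tendsto (fun n => (∑ j, (hinf j)⁻¹) / (L * γ) * (2 * Real.exp
        (-(‖w (ψ n + t₀)‖ ^ L * (q i (‖w (ψ n + t₀)‖⁻¹ • w (ψ n + t₀)) -
          q i' (‖w (ψ n + t₀)‖⁻¹ • w (ψ n + t₀))))))) atTop (𝓝 0) := by
      simpa using ((Real.tendsto_exp_neg_atTop_nhds_zero.comp hgap).const_mul 2).const_mul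
        ((∑ j, (hinf j)⁻¹) / (L * γ))
    refine le_antisymm (le_of_tendsto_of_tendsto (hlami i) (hzero.comp hφ') ?_) (hlam.1 i)
    filter_upwards [hφ'.eventually hz] with n hn
    refine (h.multiplier_le hγ hn i i').trans ?_
    have hH := h.sum_inv_pos
    simp only [Function.comp]
    gcongr
    have hrL := Real.rpow_pos_of_pos (norm_pos_iff.2 (h.ne_zero (ψ (φ n)))) L
    rw [hmargin, hmargin, ← mul_sub, mul_inv_cancel_left₀ hrL.ne', div_le_iff₀ (k.slope_pos _)]
    have h1 := k.slope_le_exp (q i (w (ψ (φ n) + t₀)))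
    have h2 := k.exp_le_two_mul_slope ((h.z_pos (ψ (φ n))).le.trans (h.le_margin _ i'))
    refine h1.trans ?_
    have h3 : Real.exp (-(q i (w (ψ (φ n) + t₀)))) =
        Real.exp (-(q i (w (ψ (φ n) + t₀)) - q i' (w (ψ (φ n) + t₀)))) *
          Real.exp (-(q i' (w (ψ (φ n) + t₀)))) := by
      rw [← Real.exp_add]
      congr 1
      ring
    rw [h3, mul_comm 2, mul_assoc]
    gcongr

end SeparatedRun

/-! ### Assembly of the theorem. -/

theorem mainTheorem7 {p N : ℕ} (hN : 0 < N) {X : Type*}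
    (Φ : EuclideanSpace ℝ (Fin p) → X → ℝ) (x : Fin N → X) (y : Fin N → ℝ) (k : LossKind)
    -- regularity: every margin is differentiable, with locally Lipschitz gradient
    (hdiff : ∀ i, Differentiable ℝ (margin Φ x y i))
    (hsmooth : ∀ i, LocallyLipschitz (gradient (margin Φ x y i)))
    -- homogeneity of degree `L`
    (L : ℝ) (hL : 0 < L)
    (hhom : ∀ i, ∀ α : ℝ, 0 < α → ∀ w, margin Φ x y i (α • w) = α ^ L * margin Φ x y i w)
    -- a run of discrete AdaGrad
    (ε : ℝ) (hε : 0 < ε) (η : ℕ → ℝ) (w : ℕ → EuclideanSpace ℝ (Fin p))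
    (hrun : IsAdaGradRun ε (empiricalLoss k (margin Φ x y)) η w)
    -- separability at time `t₀`: `f⁻¹(log (1 / ℒ(w(t₀)))) > 0`
    (t₀ : ℕ)
    (hsep : ∃ s : ℝ, 0 < s ∧
      k.f s = Real.log (1 / empiricalLoss k (margin Φ x y) (w t₀)))
    -- the loss is `M`-smooth on its sublevel set at time `t₀`
    (M : ℝ) (hM : 0 < M)
    (hlossSmooth : IsSmoothOnWith M (empiricalLoss k (margin Φ x y))
      {u | empiricalLoss k (margin Φ x y) u ≤ empiricalLoss k (margin Φ x y) (w t₀)})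
    -- learning rates
    (ηlow : ℝ) (hηlow : 0 < ηlow) (hη_lower : ∀ t, t₀ ≤ t → ηlow ≤ η t)
    (hη_upper : ∀ t, t₀ ≤ t →
      η t ≤ learningRateBound ε M (empiricalLoss k (margin Φ x y)) w t) :
    ∃ hinf : EuclideanSpace ℝ (Fin p),
      Tendsto (adaGradConditioner ε (empiricalLoss k (margin Φ x y)) w) atTop (𝓝 hinf) ∧
      (∀ j, 0 < hinf j) ∧
      ∀ wbar : EuclideanSpace ℝ (Fin p),
        MapClusterPt wbar atTop (fun t => (‖w t‖)⁻¹ • w t) →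
        ∃ c : ℝ, 0 < c ∧
          IsKKTPoint (fun u => 1 / 2 * ‖hadamardVec (powVec hinf (-(1 / 2))) u‖)
            (fun i u => 1 - margin Φ x y i u) (c • wbar) := by
  set q := margin Φ x y with hq
  set F := empiricalLoss k q with hF
  obtain ⟨B, hmodel⟩ := exists_homogeneousModel hL hdiff hsmooth hhom
  have hFd : Differentiable ℝ F := differentiable_empiricalLoss hdiff
  have hη : ∀ t, t₀ ≤ t → 0 < η t := fun t ht => hηlow.trans_le (hη_lower t ht)
  have hηj : ∀ t, t₀ ≤ t → ∀ j, M * η t ≤ (adaGradConditioner ε F w t j)⁻¹ := by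
    intro t ht j
    have h1 := hη_upper t ht
    rw [learningRateBound, le_div_iff₀' hM] at h1
    exact h1.trans (ciInf_le (Finite.bddBelow_range _) j)
  have hηM : ∀ t, t₀ ≤ t → ∀ j, M * η t * adaGradConditioner ε F w t j ≤ 1 := by
    intro t ht j
    rw [← le_div_iff₀ (adaGradConditioner_pos hε t j), one_div]
    exact hηj t ht j
  have hdesc : ∀ t, t₀ ≤ t → F (w (t + 1)) ≤ F (w t) - η t * adaGradDecrement ε F w t / 2 :=
    fun t ht => hrun.forall_le_sub hε hFd hM.le hlossSmooth (fun t ht => (hη t ht).le) hηM ht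
  have hsum : Summable (adaGradDecrement ε F w) :=
    summable_adaGradDecrement hε (half_pos hηlow) empiricalLoss_nonneg fun t ht => by
      have h1 := mul_le_mul_of_nonneg_right (hη_lower t ht)
        (adaGradDecrement_nonneg (F := F) (w := w) hε t)
      linarith [hdesc t ht]
  obtain ⟨hinf, hlim, hpos, hle⟩ := exists_tendsto_adaGradConditioner hε hsum
  refine ⟨hinf, hlim, hpos, fun wbar hwbar => ?_⟩
  obtain ⟨s, hs, hsf⟩ := hsep
  have hs' : k.loss s = F (w t₀) := by
    rw [LossKind.loss, hsf, one_div, Real.log_inv, neg_neg, Real.exp_log (empiricalLoss_pos hN _)]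
  have hanti : ∀ n, F (w (n + t₀)) ≤ F (w t₀) := by
    intro n
    induction n with
    | zero => simp
    | succ n ih =>
      have h1 := hdesc (n + t₀) (by omega)
      have h2 := mul_nonneg (hη (n + t₀) (by omega)).le
        (adaGradDecrement_nonneg (F := F) (w := w) hε (n + t₀))
      rw [add_right_comm]
      linarith
  choose z hz using fun n =>
    k.exists_loss_eq (show 0 < F (w (n + t₀)) from empiricalLoss_pos hN _)
  have hz0 : ∀ n, 0 < z n := fun n => hs.trans_le (k.loss_strictAnti.le_iff_ge.1 (by
    rw [hz, hs']
    exact hanti n))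
  -- A coordinate is needed to bound the learning rates above by `(hinf j₀)⁻¹ / M`. Without
  -- coordinates the only iterate is `0`, whose margins vanish, against separability.
  obtain ⟨j₀⟩ : Nonempty (Fin p) := by
    by_contra hempty
    rw [not_nonempty_iff] at hempty
    have h1 := le_margin_of_loss_eq (hz 0) ⟨0, hN⟩
    rw [Subsingleton.elim (w (0 + t₀)) 0,
      zero_of_homogeneous hL (hhom ⟨0, hN⟩)] at h1
    linarith [hz0 0]
  have hrunS : SeparatedRun k q L B ε η w t₀ z hinf ηlow ((hinf j₀)⁻¹ / M) :=
  { hN := hN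
    hε := hε
    hc := hηlow
    model := hmodel
    run := hrun
    z_pos := hz0
    loss_z := hz
    le_η := fun n => hη_lower _ (by omega)
    η_le := fun n => by
      rw [le_div_iff₀' hM]
      exact (hηj _ (by omega) j₀).trans (inv_anti₀ (hpos j₀) (hle _ j₀))
    descent := fun n => by
      rw [add_right_comm]
      exact hdesc (n + t₀) (by omega)
    summable_decrement := hsum
    hinf_pos := hpos
    hinf_le := hle }
  exact hrunS.exists_isKKTPoint_of_mapClusterPt hlim hwbar
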